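/- \textbf{Theorem.} A (finite, simple) graph is \emph{split} if its vertex set can be partitioned into a clique and an independent set (either may be empty). A \emph{minimal split completion} of a graph $G=(V,E)$ is a split graph $H=(V,E_H)$ with $E\subseteq E_H$ such that no split graph $H'=(V,E')$ satisfies $E\subseteq E'\subsetneq E_H$. A \emph{minimal split deletion} of $G$ is a split graph $H=(V,E_H)$ with $E_H\subseteq E$ such that no split graph $H'=(V,E')$ satisfies $E_H\subsetneq E'\subseteq E$. The minimal split completions of a graph can be enumerated with polynomial delay and polynomial space, and so can its minimal split deletions. That is, for each of the two problems there are a deterministic random access machine (with addition, truncated subtraction and comparison as its only arithmetic) and polynomials $p,q$ such that for every $n\ge 0$ and every graph $G$ on $n$ vertices, given by its adjacency matrix, the machine outputs the adjacency matrix of every minimal split completion (respectively deletion) of $G$ exactly once, outputs nothing else, and halts; the number of steps before the first output, between any two consecutive outputs, and from the last output to termination is at most $p(n)$; and at every moment the memory contents consist of at most $q(n)$ bits (the write-only output is not counted). -/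

import Mathlib

namespace SimpleGraph

variable {V : Type*}

/-- A split graph: its vertex set is partitioned into a clique `K` and an independent set. -/
def IsSplit (G : SimpleGraph V) : Prop :=
  ∃ K : Set V, G.IsClique K ∧ G.IsIndepSet Kᶜ

/-- `H` is an inclusion-wise minimal split supergraph of `G` on the same vertex set. -/
def IsMinimalSplitCompletion (G H : SimpleGraph V) : Prop :=
  Minimal (fun H' : SimpleGraph V => G ≤ H' ∧ H'.IsSplit) H

/-- `H` is an inclusion-wise maximal split subgraph of `G` on the same vertex set
(so a set of deleted edges that is inclusion-wise minimal). -/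
def IsMinimalSplitDeletion (G H : SimpleGraph V) : Prop :=
  Maximal (fun H' : SimpleGraph V => H' ≤ G ∧ H'.IsSplit) H

end SimpleGraph

/-! ### Random access machines

A program is a structured program over natural-number registers and arrays with indirect addressing.
A program mentions only finitely many registers and arrays. The only arithmetic is addition,
truncated subtraction and comparison. -/

namespace RAM

/-- Memory contents: `reg x` is the content of register `x`, `arr a i` of cell `i` of array `a`. -/
structure State where
  reg : ℕ → ℕ
  arr : ℕ → ℕ → ℕ

/-- Expressions: constants, registers, array cells, sums, truncated differences, comparisons. -/
inductive Exp where
  | const (k : ℕ)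
  | reg (x : ℕ)
  | cell (a : ℕ) (i : Exp)
  | add (e f : Exp)
  | sub (e f : Exp)
  | lt (e f : Exp)
  | eq (e f : Exp)

/-- The value of an expression. Comparisons yield `1` (true) or `0` (false). -/
def Exp.eval (σ : State) : Exp → ℕ
  | .const k => k
  | .reg x => σ.reg x
  | .cell a i => σ.arr a (i.eval σ)
  | .add e f => e.eval σ + f.eval σ
  | .sub e f => e.eval σ - f.eval σ
  | .lt e f => if e.eval σ < f.eval σ then 1 else 0
  | .eq e f => if e.eval σ = f.eval σ then 1 else 0

/-- Programs. `print e` appends the value of `e` to the solution under construction on the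
write-only output, `emit` completes that solution. A test succeeds if its value is not `0`. -/
inductive Prog where
  | skip
  | assign (x : ℕ) (e : Exp)
  | store (a : ℕ) (i e : Exp)
  | print (e : Exp)
  | emit
  | seq (c d : Prog)
  | branch (e : Exp) (c d : Prog)
  | loop (e : Exp) (c : Prog)

/-- The content of register `x` is replaced by `v`. -/
def State.setReg (σ : State) (x v : ℕ) : State :=
  { σ with reg := Function.update σ.reg x v }

/-- The content of cell `i` of array `a` is replaced by `v`. -/
def State.setCell (σ : State) (a i v : ℕ) : State :=
  { σ with arr := Function.update σ.arr a (Function.update (σ.arr a) i v) }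

/-- What an elementary step does to the output: nothing, printing one number, or completing
the current solution. -/
inductive Action where
  | silent
  | print (v : ℕ)
  | emit

/-- The record of a computation: for every elementary step, in order, its action on the output and
the memory contents after it. Its length is the running time. -/
abbrev Trace := List (Action × State)

/-- `Exec c σ τ σ'`: the program `c`, started on memory `σ`, halts with memory `σ'`, after performing
exactly the elementary steps recorded in `τ`. Every elementary command and every evaluation of
the test of a `branch` or a `loop` is one step; as expressions are part of the fixed program, a step
amounts to a number of machine operations that is bounded in terms of the program only. -/
inductive Exec : Prog → State → Trace → State → Prop where
  | skip (σ : State) : Exec .skip σ [(.silent, σ)] σ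
  | assign (x : ℕ) (e : Exp) (σ : State) :
      Exec (.assign x e) σ [(.silent, σ.setReg x (e.eval σ))] (σ.setReg x (e.eval σ))
  | store (a : ℕ) (i e : Exp) (σ : State) :
      Exec (.store a i e) σ [(.silent, σ.setCell a (i.eval σ) (e.eval σ))]
        (σ.setCell a (i.eval σ) (e.eval σ))
  | print (e : Exp) (σ : State) : Exec (.print e) σ [(.print (e.eval σ), σ)] σ
  | emit (σ : State) : Exec .emit σ [(.emit, σ)] σ
  | seq {c d : Prog} {σ₁ σ₂ σ₃ : State} {τ τ' : Trace} :
      Exec c σ₁ τ σ₂ → Exec d σ₂ τ' σ₃ → Exec (.seq c d) σ₁ (τ ++ τ') σ₃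
  | branchTrue {e : Exp} {c d : Prog} {σ σ' : State} {τ : Trace} :
      e.eval σ ≠ 0 → Exec c σ τ σ' → Exec (.branch e c d) σ ((.silent, σ) :: τ) σ'
  | branchFalse {e : Exp} {c d : Prog} {σ σ' : State} {τ : Trace} :
      e.eval σ = 0 → Exec d σ τ σ' → Exec (.branch e c d) σ ((.silent, σ) :: τ) σ'
  | loopTrue {e : Exp} {c : Prog} {σ₁ σ₂ σ₃ : State} {τ τ' : Trace} :
      e.eval σ₁ ≠ 0 → Exec c σ₁ τ σ₂ → Exec (.loop e c) σ₂ τ' σ₃ →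
        Exec (.loop e c) σ₁ ((.silent, σ₁) :: (τ ++ τ')) σ₃
  | loopFalse {e : Exp} {c : Prog} {σ : State} :
      e.eval σ = 0 → Exec (.loop e c) σ [(.silent, σ)] σ

/-- Programs are deterministic: the initial memory determines the whole computation. -/
theorem Exec.deterministic {c : Prog} {σ σ₁ : State} {τ₁ : Trace} (h₁ : Exec c σ τ₁ σ₁) :
    ∀ {τ₂ : Trace} {σ₂ : State}, Exec c σ τ₂ σ₂ → τ₁ = τ₂ ∧ σ₁ = σ₂ := by
  induction h₁ with
  | skip | assign | store | print | emit => intro τ₂ σ₂ h; cases h; exact ⟨rfl, rfl⟩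
  | seq _ _ ih ih' =>
    intro τ₂ σ₂ h
    cases h with
    | seq h h' =>
      obtain ⟨rfl, rfl⟩ := ih h
      obtain ⟨rfl, rfl⟩ := ih' h'
      exact ⟨rfl, rfl⟩
  | branchTrue he _ ih =>
    intro τ₂ σ₂ h
    cases h with
    | branchTrue _ h => obtain ⟨rfl, rfl⟩ := ih h; exact ⟨rfl, rfl⟩
    | branchFalse he' _ => exact absurd he' he
  | branchFalse he _ ih =>
    intro τ₂ σ₂ h
    cases h with
    | branchTrue he' _ => exact absurd he he'
    | branchFalse _ h => obtain ⟨rfl, rfl⟩ := ih h; exact ⟨rfl, rfl⟩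
  | loopTrue he _ _ ih ih' =>
    intro τ₂ σ₂ h
    cases h with
    | loopTrue _ h h' =>
      obtain ⟨rfl, rfl⟩ := ih h
      obtain ⟨rfl, rfl⟩ := ih' h'
      exact ⟨rfl, rfl⟩
    | loopFalse he' => exact absurd he' he
  | loopFalse he =>
    intro τ₂ σ₂ h
    cases h with
    | loopTrue he' _ _ => exact absurd he he'
    | loopFalse _ => exact ⟨rfl, rfl⟩

/-- The solutions completed in a computation, in order of output, if `w` has already been printed
of the first one. -/
def solutionsFrom (w : List ℕ) : Trace → List (List ℕ)
  | [] => []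
  | (.silent, _) :: τ => solutionsFrom w τ
  | (.print v, _) :: τ => solutionsFrom (w ++ [v]) τ
  | (.emit, _) :: τ => w :: solutionsFrom [] τ

/-- The solutions completed in a computation, in order of output. -/
def solutions (τ : Trace) : List (List ℕ) := solutionsFrom [] τ

/-- The delay of the computation is at most `d`: at most `d` consecutive steps are made without
completing a solution. This covers the time before the first solution, between two successive
solutions, and from the last solution to termination. -/
def DelayAtMost (d : ℕ) (τ : Trace) : Prop :=
  ∀ τ' : Trace, τ' <:+: τ → (∀ s ∈ τ', s.1 ≠ Action.emit) → τ'.length ≤ d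

/-- The memory contents `σ` fit in `s` cells of `s` bits per array, and `s` bits per register. For a
program with `r` registers and `a` arrays these are `(r + a * s) * s` bits in total. -/
def State.FitsIn (s : ℕ) (σ : State) : Prop :=
  (∀ x, σ.reg x < 2 ^ s) ∧ (∀ a i, σ.arr a i < 2 ^ s) ∧ ∀ a i, s ≤ i → σ.arr a i = 0

/-- Entry `k` of the adjacency matrix of `G`, listed row by row. -/
noncomputable def adjBit {n : ℕ} (G : SimpleGraph (Fin n)) (k : ℕ) : ℕ :=
  open Classical in if ∃ i j : Fin n, k = i * n + j ∧ G.Adj i j then 1 else 0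

/-- The word that represents a graph: its adjacency matrix, row by row. -/
noncomputable def encode {n : ℕ} (G : SimpleGraph (Fin n)) : List ℕ :=
  (List.range (n * n)).map (adjBit G)

/-- The initial memory on input `G`: the number of vertices in register `0`, the adjacency matrix in
array `0`, and `0` everywhere else. -/
noncomputable def input {n : ℕ} (G : SimpleGraph (Fin n)) : State where
  reg x := if x = 0 then n else 0
  arr a k := if a = 0 then adjBit G k else 0

/-- The graphs `H` with `Sol G H` can be enumerated with polynomial delay and polynomial space on
input `G`: one program, on every input graph `G`, halts after having output each of them exactly
once and nothing else, with delay polynomial in the number of vertices, and with memory polynomial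
in the number of vertices at all times. -/
def PolyDelayPolySpace
    (Sol : ∀ {n : ℕ}, SimpleGraph (Fin n) → SimpleGraph (Fin n) → Prop) : Prop :=
  ∃ (c : Prog) (p q : Polynomial ℕ), ∀ (n : ℕ) (G : SimpleGraph (Fin n)),
    ∃ (τ : Trace) (σ : State), Exec c (input G) τ σ ∧
      (∃ L : List (SimpleGraph (Fin n)),
        L.Nodup ∧ (∀ H, H ∈ L ↔ Sol G H) ∧ solutions τ = L.map encode) ∧
      DelayAtMost (p.eval n) τ ∧
      (input G).FitsIn (q.eval n) ∧ ∀ s ∈ τ, s.2.FitsIn (q.eval n)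

end RAM

/-!
Split graphs are closed under complementation, so the minimal split completions of `G` are the
complements of the minimal split deletions of `Gᶜ`. Hence it is enough to enumerate the maximal
split subgraphs of a graph `C`, which is `G` or `Gᶜ`.

*From split subgraphs to cliques.* Every split subgraph of `C` lies in the graph `C.touching K` of
all edges that touch `K`, for some maximal clique `K` of `C`, and `C.touching K` is itself split. It
is a maximal split subgraph, and comes from no other clique, unless `K` is the closed neighborhood
of a vertex `v` and some vertex outside `K` is adjacent to all neighbors of `v`. By
`SimpleGraph.isMinimalSplitDeletion_iff` and `SimpleGraph.touching_injective` the solutions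
correspond bijectively to the maximal cliques that are not `Superfluous`; superfluous ones are
closed neighborhoods of vertices, so there are at most `n` of them
(`RAM.superfluousCount_le`).

*Enumerating maximal cliques.* The vertices are processed in order. If `K` is a maximal clique on
the vertices below `k`, then `K` or `K ∪ {k}` is one on the vertices below `k + 1`, and so may be
the set of `k` and the neighbors of `k` in `K`. Admitting the latter only for the lexicographically
first `K` that yields it turns these sets into the levels of a tree without dead ends, whose leaves
are the maximal cliques of `C` (`CliqueCode.Valid.path_injective`,
`CliqueCode.MaxClique.exists_valid`). A leaf is coded by the set `b` of levels at which the second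
possibility was chosen. The successor of `b` in the lexicographic order is found on the path to
the leaf of `b` alone: set the last bit that may be set, and clear the bits after it
(`CliqueCode.value_lt_value_next`, `CliqueCode.value_next_le`). So one code is all that has to be
remembered, which gives polynomial space. Every round of the loop takes polynomial time, and all
but at most `n` rounds output a solution, which gives polynomial delay.

*The machine.* A round consists of simultaneous first-order updates of set variables, of
first-order tests, and of loops over all vertices. Such commands (`RAM.Cmd`, over the formulas
`RAM.Fm`) are compiled to programs once and for all; `RAM.Cmd.run_compile` bounds the time by a
polynomial and shows that the memory stays small.
-/

/-! ### Runs with bounded time and memory -/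

namespace RAM

/-- The truth value of a proposition, as the number `1` or `0`. -/
noncomputable def bit (p : Prop) : ℕ := open Classical in if p then 1 else 0

theorem bit_le_one (p : Prop) : bit p ≤ 1 := by
  unfold bit; split_ifs <;> simp

@[simp] theorem bit_of_true {p : Prop} (h : p) : bit p = 1 := if_pos h

@[simp] theorem bit_of_false {p : Prop} (h : ¬p) : bit p = 0 := if_neg h

theorem bit_congr {p q : Prop} (h : p ↔ q) : bit p = bit q := by rw [propext h]

/-- The state of the output: the completed solutions, and the part of the current one that has
already been printed. -/
abbrev Output := List (List ℕ) × List ℕ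

/-- The effect of the actions recorded in a trace on the output. -/
def outcome : Output → Trace → Output
  | o, [] => o
  | o, (.silent, _) :: τ => outcome o τ
  | o, (.print v, _) :: τ => outcome (o.1, o.2 ++ [v]) τ
  | o, (.emit, _) :: τ => outcome (o.1 ++ [o.2], []) τ

theorem outcome_append (o : Output) (τ τ' : Trace) :
    outcome o (τ ++ τ') = outcome (outcome o τ) τ' := by
  induction τ generalizing o with
  | nil => rfl
  | cons s τ ih => rcases s with ⟨_ | _ | _, _⟩ <;> simp [outcome, ih]

theorem outcome_fst (o : Output) (τ : Trace) :
    (outcome o τ).1 = o.1 ++ solutionsFrom o.2 τ := by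
  induction τ generalizing o with
  | nil => simp [outcome, solutionsFrom]
  | cons s τ ih => rcases s with ⟨_ | _ | _, _⟩ <;> simp [outcome, solutionsFrom, ih]

theorem outcome_fst_of_forall_ne_emit (o : Output) (τ : Trace)
    (h : ∀ s ∈ τ, s.1 ≠ Action.emit) : (outcome o τ).1 = o.1 := by
  induction τ generalizing o with
  | nil => rfl
  | cons s τ ih =>
    have h' : ∀ s ∈ τ, s.1 ≠ Action.emit := fun t ht => h t (List.mem_cons_of_mem _ ht)
    rcases s with ⟨_ | _ | _, _⟩
    · simp [outcome, ih _ h']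
    · simp [outcome, ih _ h']
    · exact absurd rfl (h _ List.mem_cons_self)

/-- Memory contents that are small relative to the number `n` of vertices: registers hold at most
`n * n + n + 1`, arrays hold bits and are zero from cell `n * n` on. -/
def State.Tame (n : ℕ) (σ : State) : Prop :=
  (∀ x, σ.reg x ≤ n * n + n + 1) ∧ (∀ a i, σ.arr a i ≤ 1) ∧ ∀ a i, n * n ≤ i → σ.arr a i = 0

theorem State.Tame.fitsIn {n : ℕ} {σ : State} (h : σ.Tame n) : σ.FitsIn (n * n + n + 2) := by
  have h2 : n * n + n + 2 < 2 ^ (n * n + n + 2) := Nat.lt_two_pow_self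
  exact ⟨fun x => by have := h.1 x; omega, fun a i => by have := h.2.1 a i; omega,
    fun a i hi => h.2.2 a i (by omega)⟩

theorem State.Tame.setReg {n : ℕ} {σ : State} (h : σ.Tame n) {x v : ℕ}
    (hv : v ≤ n * n + n + 1) : (σ.setReg x v).Tame n := by
  refine ⟨fun y => ?_, h.2⟩
  by_cases hy : y = x
  · subst hy; simpa [State.setReg] using hv
  · simpa [State.setReg, hy] using h.1 y

theorem State.Tame.setCell {n : ℕ} {σ : State} (h : σ.Tame n) {a i v : ℕ}
    (hi : i < n) (hv : v ≤ 1) : (σ.setCell a i v).Tame n := by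
  refine ⟨h.1, fun b j => ?_, fun b j hj => ?_⟩
  · by_cases hb : b = a
    · subst hb
      by_cases hj : j = i
      · subst hj; simpa [State.setCell] using hv
      · simpa [State.setCell, hj] using h.2.1 b j
    · simpa [State.setCell, hb] using h.2.1 b j
  · by_cases hb : b = a
    · subst hb
      have : j ≠ i := by
        rintro rfl
        nlinarith
      simpa [State.setCell, this] using h.2.2 b j hj
    · simpa [State.setCell, hb] using h.2.2 b j hj

@[simp] theorem State.setReg_arr (σ : State) (x v : ℕ) : (σ.setReg x v).arr = σ.arr := rfl

@[simp] theorem State.setReg_reg_self (σ : State) (x v : ℕ) : (σ.setReg x v).reg x = v := by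
  simp [State.setReg]

theorem State.setReg_reg_of_ne (σ : State) {x y : ℕ} (v : ℕ) (h : y ≠ x) :
    (σ.setReg x v).reg y = σ.reg y := by
  simp [State.setReg, h]

/-- Started on memory `σ` with output `o`, the program `c` halts within `T` steps with memory `σ'`
and output `o'`, and the memory is tame after every step. -/
def Run (n : ℕ) (c : Prog) (T : ℕ) (σ : State) (o : Output) (σ' : State) (o' : Output) : Prop :=
  ∃ τ, Exec c σ τ σ' ∧ τ.length ≤ T ∧ (∀ s ∈ τ, s.2.Tame n) ∧ outcome o τ = o'

namespace Run

variable {n : ℕ} {c d : Prog} {T T' : ℕ} {σ σ₁ σ₂ : State} {o o₁ o₂ : Output}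

theorem mono (h : Run n c T σ o σ₁ o₁) (hT : T ≤ T') : Run n c T' σ o σ₁ o₁ := by
  obtain ⟨τ, h1, h2, h3⟩ := h
  exact ⟨τ, h1, h2.trans hT, h3⟩

theorem skip (h : σ.Tame n) : Run n .skip 1 σ o σ o :=
  ⟨_, .skip σ, le_rfl, by simpa using h, rfl⟩

theorem assign {x v : ℕ} {e : Exp} (h : (σ.setReg x v).Tame n) (he : e.eval σ = v) :
    Run n (.assign x e) 1 σ o (σ.setReg x v) o := by
  subst he
  exact ⟨_, .assign x e σ, le_rfl, by simpa using h, rfl⟩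

theorem store {a j v : ℕ} {i e : Exp} (h : (σ.setCell a j v).Tame n) (hi : i.eval σ = j)
    (he : e.eval σ = v) : Run n (.store a i e) 1 σ o (σ.setCell a j v) o := by
  subst he hi
  exact ⟨_, .store a i e σ, le_rfl, by simpa using h, rfl⟩

theorem print {v : ℕ} {e : Exp} (h : σ.Tame n) (he : e.eval σ = v) :
    Run n (.print e) 1 σ o σ (o.1, o.2 ++ [v]) := by
  subst he
  exact ⟨_, .print e σ, le_rfl, by simpa using h, rfl⟩

theorem emit (h : σ.Tame n) : Run n .emit 1 σ o σ (o.1 ++ [o.2], []) :=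
  ⟨_, .emit σ, le_rfl, by simpa using h, rfl⟩

theorem seq (h : Run n c T σ o σ₁ o₁) (h' : Run n d T' σ₁ o₁ σ₂ o₂) :
    Run n (.seq c d) (T + T') σ o σ₂ o₂ := by
  obtain ⟨τ, h1, h2, h3, h4⟩ := h
  obtain ⟨τ', h1', h2', h3', h4'⟩ := h'
  refine ⟨τ ++ τ', .seq h1 h1', by simp; omega, ?_, by rw [outcome_append, h4, h4']⟩
  intro s hs
  rcases List.mem_append.1 hs with hs | hs
  exacts [h3 s hs, h3' s hs]

theorem branchTrue {e : Exp} (hσ : σ.Tame n) (he : e.eval σ ≠ 0) (h : Run n c T σ o σ₁ o₁) :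
    Run n (.branch e c d) (T + 1) σ o σ₁ o₁ := by
  obtain ⟨τ, h1, h2, h3, h4⟩ := h
  exact ⟨_, .branchTrue he h1, by simpa using h2, by simpa [hσ] using h3,
    by simpa [outcome] using h4⟩

theorem branchFalse {e : Exp} (hσ : σ.Tame n) (he : e.eval σ = 0) (h : Run n d T σ o σ₁ o₁) :
    Run n (.branch e c d) (T + 1) σ o σ₁ o₁ := by
  obtain ⟨τ, h1, h2, h3, h4⟩ := h
  exact ⟨_, .branchFalse he h1, by simpa using h2, by simpa [hσ] using h3,
    by simpa [outcome] using h4⟩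

theorem loopTrue {e : Exp} (hσ : σ.Tame n) (he : e.eval σ ≠ 0) (h : Run n c T σ o σ₁ o₁)
    (h' : Run n (.loop e c) T' σ₁ o₁ σ₂ o₂) : Run n (.loop e c) (T + T' + 1) σ o σ₂ o₂ := by
  obtain ⟨τ, h1, h2, h3, h4⟩ := h
  obtain ⟨τ', h1', h2', h3', h4'⟩ := h'
  refine ⟨_, .loopTrue he h1 h1', by simp; omega, ?_, by simp [outcome, outcome_append, h4, h4']⟩
  intro s hs
  rcases List.mem_cons.1 hs with rfl | hs
  · exact hσ
  rcases List.mem_append.1 hs with hs | hs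
  exacts [h3 s hs, h3' s hs]

theorem loopFalse {e : Exp} (hσ : σ.Tame n) (he : e.eval σ = 0) :
    Run n (.loop e c) 1 σ o σ o :=
  ⟨_, .loopFalse he, le_rfl, by simpa using hσ, rfl⟩

end Run

/-! ### Counting loops -/

/-- The loop that executes `c` for `i = 0, …, n - 1`, where `n` is the content of register `0`. At
nesting depth `k` the counter `i` is kept in register `3 * k + 3`; register `3 * k + 4` holds
`i * n`, the offset of row `i` in an `n × n` matrix, which replaces multiplication. -/
def forLoop (k : ℕ) (c : Prog) : Prog :=
  .seq (.assign (3 * k + 3) (.const 0)) <| .seq (.assign (3 * k + 4) (.const 0)) <|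
    .loop (.lt (.reg (3 * k + 3)) (.reg 0)) <| .seq c <|
      .seq (.assign (3 * k + 3) (.add (.reg (3 * k + 3)) (.const 1)))
        (.assign (3 * k + 4) (.add (.reg (3 * k + 4)) (.reg 0)))

/-- The memory is tame, register `0` holds `n`, and the counter at depth `k` is `i`. -/
structure Counter (n k i : ℕ) (σ : State) : Prop where
  tame : σ.Tame n
  size : σ.reg 0 = n
  index : σ.reg (3 * k + 3) = i
  row : σ.reg (3 * k + 4) = i * n

/-- An invariant `I` of the body of a counting loop, indexed by the value of the counter, holds
after the loop. -/
theorem run_forLoop {n k T : ℕ} {c : Prog} {I : ℕ → State → Output → Prop}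
    (hset : ∀ i σ o x v, x = 3 * k + 3 ∨ x = 3 * k + 4 → I i σ o → I i (σ.setReg x v) o)
    (hbody : ∀ i < n, ∀ σ o, I i σ o → Counter n k i σ →
      ∃ σ' o', Run n c T σ o σ' o' ∧ I (i + 1) σ' o' ∧ Counter n k i σ')
    {σ : State} {o : Output} (hσ : σ.Tame n) (h0 : σ.reg 0 = n) (hI : I 0 σ o) :
    ∃ σ' o', Run n (forLoop k c) (n * (T + 3) + 3) σ o σ' o' ∧ I n σ' o' ∧ σ'.Tame n ∧
      σ'.reg 0 = n := by
  have key : ∀ j i, i + j = n → ∀ σ o, I i σ o → Counter n k i σ →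
      ∃ σ' o', Run n (.loop (.lt (.reg (3 * k + 3)) (.reg 0)) <| .seq c <|
        .seq (.assign (3 * k + 3) (.add (.reg (3 * k + 3)) (.const 1)))
          (.assign (3 * k + 4) (.add (.reg (3 * k + 4)) (.reg 0)))) (j * (T + 3) + 1) σ o σ' o' ∧
        I n σ' o' ∧ σ'.Tame n ∧ σ'.reg 0 = n := by
    intro j
    induction j with
    | zero =>
      intro i hi σ o hI hC
      obtain rfl : i = n := by omega
      refine ⟨σ, o, (Run.loopFalse hC.tame ?_).mono (by omega), hI, hC.tame, hC.size⟩
      simp [Exp.eval, hC.index, hC.size]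
    | succ j ih =>
      intro i hi σ o hI hC
      have hin : i < n := by omega
      obtain ⟨σ₁, o₁, hr, hI₁, hC₁⟩ := hbody i hin σ o hI hC
      have hle : i * n + n ≤ n * n := by nlinarith
      have ht₁ : (σ₁.setReg (3 * k + 3) (i + 1)).Tame n := hC₁.tame.setReg (by nlinarith)
      have ht₂ : ((σ₁.setReg (3 * k + 3) (i + 1)).setReg (3 * k + 4) ((i + 1) * n)).Tame n :=
        ht₁.setReg (by nlinarith)
      obtain ⟨σ₂, o₂, hr₂, h₂⟩ := ih (i + 1) (by omega)
        ((σ₁.setReg (3 * k + 3) (i + 1)).setReg (3 * k + 4) ((i + 1) * n)) o₁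
        (hset _ _ _ _ _ (.inr rfl) (hset _ _ _ _ _ (.inl rfl) hI₁))
        ⟨ht₂, by simp [State.setReg, hC₁.size], by simp [State.setReg], by simp [State.setReg]⟩
      refine ⟨σ₂, o₂, (Run.loopTrue hC.tame ?_ (hr.seq ((Run.assign ht₁ ?_).seq
        (Run.assign ht₂ ?_))) hr₂).mono (by ring_nf; omega), h₂⟩
      · simp [Exp.eval, hC.index, hC.size, hin]
      · simp [Exp.eval, hC₁.index]
      · simp [Exp.eval, State.setReg, hC₁.row, hC₁.size, Nat.add_mul]
  have ht₁ : (σ.setReg (3 * k + 3) 0).Tame n := hσ.setReg (by omega)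
  have ht₂ : ((σ.setReg (3 * k + 3) 0).setReg (3 * k + 4) 0).Tame n := ht₁.setReg (by omega)
  obtain ⟨σ₂, o₂, hr₂, h₂⟩ := key n 0 (by omega) _ o
    (hset _ _ _ _ _ (.inr rfl) (hset _ _ _ _ _ (.inl rfl) hI))
    ⟨ht₂, by simp [State.setReg, h0], by simp [State.setReg], by simp [State.setReg]⟩
  exact ⟨σ₂, o₂, ((Run.assign ht₁ rfl).seq ((Run.assign ht₂ rfl).seq hr₂)).mono (by omega), h₂⟩

/-! ### First-order formulas and their evaluation -/

/-- Whether `i` and `j` are adjacent vertices of `G`, for natural numbers `i` and `j`. -/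
def NatAdj {n : ℕ} (G : SimpleGraph (Fin n)) (i j : ℕ) : Prop :=
  ∃ (hi : i < n) (hj : j < n), G.Adj ⟨i, hi⟩ ⟨j, hj⟩

theorem adjBit_eq {n : ℕ} (G : SimpleGraph (Fin n)) {i j : ℕ} (hj : j < n) :
    adjBit G (i * n + j) = bit (NatAdj G i j) := by
  unfold adjBit bit
  congr 1
  apply propext
  constructor
  · rintro ⟨a, b, h, hab⟩
    have hb := b.2
    have h1 : i = a := by
      have := congrArg (· / n) h
      simpa [Nat.add_div_of_dvd_right, Nat.div_eq_of_lt, hj, hb,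
        Nat.pos_of_ne_zero (by omega : n ≠ 0)] using this
    have h2 : j = b := by
      have := congrArg (· % n) h
      simpa [Nat.mod_eq_of_lt, hj, hb] using this
    subst h1 h2
    exact ⟨a.2, b.2, hab⟩
  · rintro ⟨hi, hj, h⟩
    exact ⟨_, _, rfl, h⟩

theorem adjBit_eq_zero {n : ℕ} (G : SimpleGraph (Fin n)) {k : ℕ} (hk : n * n ≤ k) :
    adjBit G k = 0 := by
  refine if_neg ?_
  rintro ⟨i, j, rfl, -⟩
  have := i.2
  have := j.2
  nlinarith

/-- First-order formulas over the vertices `0, …, n - 1` of the input graph with its adjacency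
relation, the order of the vertices, and set variables. Vertex variables are numbered by nesting
depth: a quantifier below `k` others binds variable `k`. -/
inductive Fm where
  | edge (x y : ℕ)
  | mem (a x : ℕ)
  | lt (x y : ℕ)
  | not (φ : Fm)
  | and (φ ψ : Fm)
  | all (φ : Fm)

namespace Fm

/-- The truth of a formula at depth `k`, for vertex variables `v` and set variables `m`. -/
def Holds {n : ℕ} (G : SimpleGraph (Fin n)) (m : ℕ → Set ℕ) : Fm → ℕ → (ℕ → ℕ) → Prop
  | edge x y, _, v => NatAdj G (v x) (v y)
  | mem a x, _, v => v x ∈ m a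
  | lt x y, _, v => v x < v y
  | not φ, k, v => ¬φ.Holds G m k v
  | and φ ψ, k, v => φ.Holds G m k v ∧ ψ.Holds G m k v
  | all φ, k, v => ∀ i < n, φ.Holds G m (k + 1) (Function.update v k i)

/-- All free vertex variables of a formula at depth `k` are smaller than `k`. -/
def Scoped : Fm → ℕ → Prop
  | edge x y, k => x < k ∧ y < k
  | mem _ x, k => x < k
  | lt x y, k => x < k ∧ y < k
  | not φ, k => φ.Scoped k
  | and φ ψ, k => φ.Scoped k ∧ ψ.Scoped k
  | all φ, k => φ.Scoped (k + 1)

/-- The program that evaluates a formula at depth `k` into register `1`. Set variable `a` is kept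
in array `a + 2`. For a quantifier at depth `k`, register `3 * k + 5` records whether a
counterexample has been found. -/
def compile : Fm → ℕ → Prog
  | edge x y, _ => .assign 1 (.cell 0 (.add (.reg (3 * x + 4)) (.reg (3 * y + 3))))
  | mem a x, _ => .assign 1 (.cell (a + 2) (.reg (3 * x + 3)))
  | lt x y, _ => .assign 1 (.lt (.reg (3 * x + 3)) (.reg (3 * y + 3)))
  | not φ, k => .seq (φ.compile k) (.assign 1 (.eq (.reg 1) (.const 0)))
  | and φ ψ, k => .seq (φ.compile k) (.branch (.reg 1) (ψ.compile k) .skip)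
  | all φ, k => .seq (.assign (3 * k + 5) (.const 1)) <|
      .seq (forLoop k (.seq (φ.compile (k + 1))
        (.branch (.reg 1) .skip (.assign (3 * k + 5) (.const 0)))))
        (.assign 1 (.reg (3 * k + 5)))

/-- A bound on the running time of the evaluation of a formula, in terms of `n`. -/
noncomputable def time : Fm → Polynomial ℕ
  | edge _ _ | mem _ _ | lt _ _ => 1
  | not φ => φ.time + 1
  | and φ ψ => φ.time + (ψ.time + 2)
  | all φ => Polynomial.X * (φ.time + 5) + 5

end Fm

/-- The memory represents the graph `G`, the values `v` of the first `k` vertex variables, and the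
values `m` of the set variables. -/
structure Represents {n : ℕ} (G : SimpleGraph (Fin n)) (k : ℕ) (v : ℕ → ℕ) (m : ℕ → Set ℕ)
    (σ : State) : Prop where
  size : σ.reg 0 = n
  index : ∀ i < k, σ.reg (3 * i + 3) = v i
  row : ∀ i < k, σ.reg (3 * i + 4) = v i * n
  bound : ∀ i < k, v i < n
  graph : ∀ j, σ.arr 0 j = adjBit G j
  sets : ∀ a, ∀ i < n, σ.arr (a + 2) i = bit (i ∈ m a)

/-- The registers that belong to depths smaller than `k` are unchanged. -/
def Frame (k : ℕ) (σ σ' : State) : Prop := ∀ x, x ≠ 1 → x < 3 * k + 3 → σ'.reg x = σ.reg x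

namespace Represents

variable {n : ℕ} {G : SimpleGraph (Fin n)} {k : ℕ} {v : ℕ → ℕ} {m : ℕ → Set ℕ} {σ σ' : State}

theorem of_frame (h : Represents G k v m σ) (ha : σ'.arr = σ.arr) (hF : Frame k σ σ') :
    Represents G k v m σ' where
  size := by rw [hF 0 (by omega) (by omega), h.size]
  index i hi := by rw [hF _ (by omega) (by omega), h.index i hi]
  row i hi := by rw [hF _ (by omega) (by omega), h.row i hi]
  bound := h.bound
  graph := by rw [ha]; exact h.graph
  sets := by rw [ha]; exact h.sets

theorem push (h : Represents G k v m σ) {i : ℕ} (hi : i < n) (hC : Counter n k i σ) :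
    Represents G (k + 1) (Function.update v k i) m σ := by
  refine ⟨h.size, fun j hj => ?_, fun j hj => ?_, fun j hj => ?_, h.graph, h.sets⟩ <;>
  · rcases Nat.lt_succ_iff_lt_or_eq.1 hj with hj | rfl
    · simp [hj.ne, h.index j hj, h.row j hj, h.bound j hj]
    · simp [hC.index, hC.row, hi]

theorem pop {i : ℕ} (h : Represents G (k + 1) (Function.update v k i) m σ) :
    Represents G k v m σ := by
  refine ⟨h.size, fun j hj => ?_, fun j hj => ?_, fun j hj => ?_, h.graph, h.sets⟩
  · simpa [hj.ne] using h.index j (by omega)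
  · simpa [hj.ne] using h.row j (by omega)
  · simpa [hj.ne] using h.bound j (by omega)

theorem counter {i : ℕ} (h : Represents G (k + 1) (Function.update v k i) m σ)
    (hσ : σ.Tame n) : Counter n k i σ :=
  ⟨hσ, h.size, by simpa using h.index k (by omega), by simpa using h.row k (by omega)⟩

end Represents

theorem Frame.refl (k : ℕ) (σ : State) : Frame k σ σ := fun _ _ _ => rfl

theorem Frame.trans {k l : ℕ} {σ₁ σ₂ σ₃ : State} (h : Frame k σ₁ σ₂) (h' : Frame l σ₂ σ₃)
    (hkl : k ≤ l) : Frame k σ₁ σ₃ :=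
  fun x hx hxk => by rw [h' x hx (by omega), h x hx hxk]

theorem Frame.setReg {k x v : ℕ} {σ σ' : State} (h : Frame k σ σ') (hx : x = 1 ∨ 3 * k + 3 ≤ x) :
    Frame k σ (σ'.setReg x v) := fun y hy hyk => by
  rw [State.setReg_reg_of_ne _ _ (by omega), h y hy hyk]

theorem Fm.run_compile {n : ℕ} (G : SimpleGraph (Fin n)) (m : ℕ → Set ℕ) (φ : Fm) :
    ∀ (k : ℕ) (v : ℕ → ℕ) (σ : State) (o : Output), φ.Scoped k → σ.Tame n →
      Represents G k v m σ → ∃ σ', Run n (φ.compile k) (φ.time.eval n) σ o σ' o ∧ σ'.Tame n ∧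
        σ'.reg 1 = bit (φ.Holds G m k v) ∧ σ'.arr = σ.arr ∧ Frame k σ σ' := by
  have atom : ∀ (σ : State) (k : ℕ) (e : Exp) (p : Prop) (o : Output), σ.Tame n →
      e.eval σ = bit p → ∃ σ', Run n (.assign 1 e) ((1 : Polynomial ℕ).eval n) σ o σ' o ∧
        σ'.Tame n ∧ σ'.reg 1 = bit p ∧ σ'.arr = σ.arr ∧ Frame k σ σ' := by
    intro σ k e p o hσ he
    have ht : (σ.setReg 1 (bit p)).Tame n := hσ.setReg (by have := bit_le_one p; omega)
    exact ⟨_, (Run.assign ht he).mono (by simp), ht, by simp, rfl,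
      (Frame.refl k σ).setReg (.inl rfl)⟩
  induction φ with
  | edge x y =>
    intro k v σ o hφ hσ h
    refine atom σ k _ _ o hσ ?_
    simp only [Exp.eval, h.row x hφ.1, h.index y hφ.2, h.graph]
    exact adjBit_eq G (h.bound y hφ.2)
  | mem a x =>
    intro k v σ o hφ hσ h
    refine atom σ k _ _ o hσ ?_
    simp only [Exp.eval, h.index x hφ]
    exact h.sets a _ (h.bound x hφ)
  | lt x y =>
    intro k v σ o hφ hσ h
    refine atom σ k _ _ o hσ ?_
    simp only [Exp.eval, h.index x hφ.1, h.index y hφ.2, Holds]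
    by_cases hv : v x < v y <;> simp [hv]
  | not φ ih =>
    intro k v σ o hφ hσ h
    obtain ⟨σ₁, hr, ht, h1, ha, hF⟩ := ih k v σ o hφ hσ h
    have ht' : (σ₁.setReg 1 (bit (Fm.Holds G m (.not φ) k v))).Tame n :=
      ht.setReg (by have := bit_le_one (Fm.Holds G m (.not φ) k v); omega)
    refine ⟨_, (hr.seq (Run.assign ht' ?_)).mono (by simp [time]), ht', by simp, ha,
      hF.setReg (.inl rfl)⟩
    by_cases hp : φ.Holds G m k v <;> simp [Exp.eval, h1, Holds, hp]
  | and φ ψ ih ih' =>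
    intro k v σ o hφ hσ h
    obtain ⟨σ₁, hr, ht, h1, ha, hF⟩ := ih k v σ o hφ.1 hσ h
    by_cases hp : φ.Holds G m k v
    · obtain ⟨σ₂, hr', ht', h1', ha', hF'⟩ := ih' k v σ₁ o hφ.2 ht (h.of_frame ha hF)
      refine ⟨σ₂, (hr.seq (Run.branchTrue ht ?_ hr')).mono (by simp [time]), ht', ?_,
        ha'.trans ha, hF.trans hF' le_rfl⟩
      · simp [Exp.eval, h1, hp]
      · rw [h1']; exact bit_congr (by simp [Holds, hp])
    · refine ⟨σ₁, (hr.seq (Run.branchFalse ht ?_ (.skip ht))).mono (by simp [time]), ht, ?_,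
        ha, hF⟩
      · simp [Exp.eval, h1, hp]
      · rw [h1]; exact bit_congr (by simp [Holds, hp])
  | all φ ih =>
    intro k v σ o hφ hσ h
    have ht₀ : (σ.setReg (3 * k + 5) 1).Tame n := hσ.setReg (by omega)
    have hF₀ : Frame k σ (σ.setReg (3 * k + 5) 1) := (Frame.refl k σ).setReg (.inr (by omega))
    obtain ⟨σ₁, o₁, hr, ⟨rfl, ha, hF, hf⟩, ht, hs⟩ := run_forLoop (n := n) (k := k)
      (T := φ.time.eval n + 2)
      (c := .seq (φ.compile (k + 1)) (.branch (.reg 1) .skip (.assign (3 * k + 5) (.const 0))))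
      (I := fun i σ' o' => o' = o ∧ σ'.arr = σ.arr ∧ Frame k σ σ' ∧ σ'.reg (3 * k + 5) =
        bit (∀ j < i, φ.Holds G m (k + 1) (Function.update v k j)))
      (by
        rintro i σ' o' x u hx ⟨h1, h2, h3, h4⟩
        exact ⟨h1, h2, h3.setReg (by omega),
          by rw [State.setReg_reg_of_ne _ _ (by omega), h4]⟩)
      (by
        rintro i hi σ' o' ⟨rfl, ha, hF, hf⟩ hC
        have hrep := (h.of_frame ha hF).push hi hC
        obtain ⟨σ₁, hr, ht, h1, ha₁, hF₁⟩ := ih (k + 1) _ σ' o' hφ hC.tame hrep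
        by_cases hp : φ.Holds G m (k + 1) (Function.update v k i)
        · refine ⟨σ₁, o', hr.seq (Run.branchTrue ht ?_ (.skip ht)),
            ⟨rfl, ha₁.trans ha, hF.trans hF₁ (by omega), ?_⟩,
            (hrep.of_frame ha₁ hF₁).counter ht⟩
          · simp [Exp.eval, h1, hp]
          · rw [hF₁ _ (by omega) (by omega), hf]
            refine bit_congr ⟨fun H j hj => ?_, fun H j hj => H j (by omega)⟩
            rcases Nat.lt_succ_iff_lt_or_eq.1 hj with hj | rfl
            exacts [H j hj, hp]
        · have ht' : (σ₁.setReg (3 * k + 5) 0).Tame n := ht.setReg (by omega)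
          refine ⟨_, o', hr.seq (Run.branchFalse ht ?_ (.assign ht' rfl)),
            ⟨rfl, ha₁.trans ha, (hF.trans hF₁ (by omega)).setReg (.inr (by omega)), ?_⟩, ?_⟩
          · simp [Exp.eval, h1, hp]
          · rw [State.setReg_reg_self, bit_of_false]
            exact fun H => hp (H i (by omega))
          · have := (hrep.of_frame ha₁ hF₁).counter ht
            refine ⟨ht', ?_, ?_, ?_⟩ <;> rw [State.setReg_reg_of_ne _ _ (by omega)]
            exacts [this.size, this.index, this.row])
      ht₀ (by rw [State.setReg_reg_of_ne _ _ (by omega), h.size])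
      (show o = o ∧ _ from ⟨rfl, rfl, hF₀, by simp⟩)
    have ht' : (σ₁.setReg 1 (bit (Fm.Holds G m (.all φ) k v))).Tame n :=
      ht.setReg (by have := bit_le_one (Fm.Holds G m (.all φ) k v); omega)
    refine ⟨_, ((Run.assign ht₀ rfl).seq (hr.seq (Run.assign ht' ?_))).mono ?_, ht', by simp, ha,
      hF.setReg (.inl rfl)⟩
    · simp only [Exp.eval, hf, Holds]
    · simp [time]; ring_nf; omega

/-! ### Commands on set variables -/

/-- Commands on set variables, the control flow being first-order tests and counting loops.
`set a φ` replaces the set `a` by the set of all vertices that satisfy `φ`, where `φ` refers to the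
old value of `a`; like a quantifier, it binds a vertex variable in `φ`, and so does `for_`. -/
inductive Cmd where
  | set (a : ℕ) (φ : Fm)
  | print (φ : Fm)
  | emit
  | seq (c d : Cmd)
  | when_ (φ : Fm) (c : Cmd)
  | for_ (c : Cmd)

namespace Cmd

/-- The effect of a command at depth `k` on the set variables and the output. -/
noncomputable def den {n : ℕ} (G : SimpleGraph (Fin n)) :
    Cmd → ℕ → (ℕ → ℕ) → (ℕ → Set ℕ) × Output → (ℕ → Set ℕ) × Output
  | set a φ, k, v, s =>
    (Function.update s.1 a {i | i < n ∧ φ.Holds G s.1 (k + 1) (Function.update v k i)}, s.2)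
  | print φ, k, v, s => (s.1, s.2.1, s.2.2 ++ [bit (φ.Holds G s.1 k v)])
  | emit, _, _, s => (s.1, s.2.1 ++ [s.2.2], [])
  | seq c d, k, v, s => d.den G k v (c.den G k v s)
  | when_ φ c, k, v, s => open Classical in if φ.Holds G s.1 k v then c.den G k v s else s
  | for_ c, k, v, s =>
    (List.range n).foldl (fun s i => c.den G (k + 1) (Function.update v k i) s) s

/-- All free vertex variables of a command at depth `k` are smaller than `k`. -/
def Scoped : Cmd → ℕ → Prop
  | set _ φ, k => φ.Scoped (k + 1)
  | print φ, k => φ.Scoped k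
  | emit, _ => True
  | seq c d, k => c.Scoped k ∧ d.Scoped k
  | when_ φ c, k => φ.Scoped k ∧ c.Scoped k
  | for_ c, k => c.Scoped (k + 1)

/-- The program that carries out a command at depth `k`. Array `1` holds the new value of a set
while its old value is still needed. -/
def compile : Cmd → ℕ → Prog
  | set a φ, k => .seq (forLoop k (.seq (φ.compile (k + 1)) (.store 1 (.reg (3 * k + 3)) (.reg 1))))
      (forLoop k (.store (a + 2) (.reg (3 * k + 3)) (.cell 1 (.reg (3 * k + 3)))))
  | print φ, k => .seq (φ.compile k) (.print (.reg 1))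
  | emit, _ => .emit
  | seq c d, k => .seq (c.compile k) (d.compile k)
  | when_ φ c, k => .seq (φ.compile k) (.branch (.reg 1) (c.compile k) .skip)
  | for_ c, k => forLoop k (c.compile (k + 1))

/-- A bound on the running time of a command, in terms of `n`. -/
noncomputable def time : Cmd → Polynomial ℕ
  | set _ φ => Polynomial.X * (φ.time + 1 + 3) + 3 + (Polynomial.X * (1 + 3) + 3)
  | print φ => φ.time + 1
  | emit => 1
  | seq c d => c.time + d.time
  | when_ φ c => φ.time + (c.time + 2)
  | for_ c => Polynomial.X * (c.time + 3) + 3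

theorem run_compile {n : ℕ} (G : SimpleGraph (Fin n)) (c : Cmd) :
    ∀ (k : ℕ) (v : ℕ → ℕ) (σ : State) (m : ℕ → Set ℕ) (o : Output), c.Scoped k → σ.Tame n →
      Represents G k v m σ → ∃ σ', Run n (c.compile k) (c.time.eval n) σ o σ'
        (c.den G k v (m, o)).2 ∧ σ'.Tame n ∧ Represents G k v (c.den G k v (m, o)).1 σ' ∧
        Frame k σ σ' := by
  induction c with
  | set a φ =>
    intro k v σ m o hφ hσ h
    set S : Set ℕ := {i | i < n ∧ φ.Holds G m (k + 1) (Function.update v k i)} with hS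
    obtain ⟨σ₁, o₁, hr, ⟨rfl, hrep, hF, h1⟩, ht, hs⟩ := run_forLoop (n := n) (k := k)
      (T := φ.time.eval n + 1)
      (c := .seq (φ.compile (k + 1)) (.store 1 (.reg (3 * k + 3)) (.reg 1)))
      (I := fun i σ' o' => o' = o ∧ Represents G k v m σ' ∧ Frame k σ σ' ∧
        ∀ j < i, σ'.arr 1 j = bit (j ∈ S))
      (by
        rintro i σ' o' x u hx ⟨h1, h2, h3, h4⟩
        exact ⟨h1, h2.of_frame rfl ((Frame.refl k σ').setReg (by omega)), h3.setReg (by omega), h4⟩)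
      (by
        rintro i hi σ' o' ⟨rfl, hrep, hF, h1⟩ hC
        have hrep' := hrep.push hi hC
        obtain ⟨σ₁, hr, ht, hv, ha₁, hF₁⟩ := φ.run_compile G m (k + 1) _ σ' o' hφ hC.tame hrep'
        have hrep₁ := hrep'.of_frame ha₁ hF₁
        have hC₁ := hrep₁.counter ht
        have ht' : (σ₁.setCell 1 i (bit (i ∈ S))).Tame n := ht.setCell hi (bit_le_one _)
        refine ⟨_, o', hr.seq (Run.store ht' ?_ ?_), ⟨rfl, ?_, hF.trans hF₁ (by omega), ?_⟩,
          ⟨ht', hC₁.size, hC₁.index, hC₁.row⟩⟩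
        · simp [Exp.eval, hC₁.index]
        · simp [Exp.eval, hv, hS, hi]
        · have := hrep₁.pop
          exact ⟨this.size, this.index, this.row, this.bound, by simpa [State.setCell] using
            this.graph, by simpa [State.setCell] using this.sets⟩
        · intro j hj
          by_cases hji : j = i
          · simp [State.setCell, hji]
          · simp [State.setCell, hji, ha₁, h1 j (by omega)])
      hσ h.size (show o = o ∧ _ from ⟨rfl, h, Frame.refl k σ, by simp⟩)
    obtain ⟨σ₂, o₂, hr₂, ⟨rfl, hrep₂, hF₂, -⟩, ht₂, -⟩ := run_forLoop (n := n) (k := k)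
      (T := 1) (c := .store (a + 2) (.reg (3 * k + 3)) (.cell 1 (.reg (3 * k + 3))))
      (I := fun i σ' o' => o' = o₁ ∧
        Represents G k v (Function.update m a {j | (j < i ∧ j ∈ S) ∨ (i ≤ j ∧ j ∈ m a)}) σ' ∧
        Frame k σ σ' ∧ ∀ j < n, σ'.arr 1 j = bit (j ∈ S))
      (by
        rintro i σ' o' x u hx ⟨h1, h2, h3, h4⟩
        exact ⟨h1, h2.of_frame rfl ((Frame.refl k σ').setReg (by omega)), h3.setReg (by omega), h4⟩)
      (by
        rintro i hi σ' o' ⟨rfl, hrep, hF, h1⟩ hC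
        have ht' : (σ'.setCell (a + 2) i (bit (i ∈ S))).Tame n := hC.tame.setCell hi (bit_le_one _)
        refine ⟨_, o', Run.store ht' ?_ ?_, ⟨rfl, ⟨hrep.size, hrep.index, hrep.row, hrep.bound,
          ?_, ?_⟩, hF, ?_⟩, ⟨ht', hC.size, hC.index, hC.row⟩⟩
        · simp [Exp.eval, hC.index]
        · simp [Exp.eval, hC.index, h1 i hi]
        · simpa [State.setCell] using hrep.graph
        · intro b j hj
          have hb := hrep.sets b j hj
          by_cases hba : b = a
          · subst hba
            by_cases hji : j = i
            · subst hji
              simp only [State.setCell, Function.update_self]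
              exact bit_congr (by simp)
            · simp only [State.setCell, Function.update_self, Function.update_of_ne hji] at hb ⊢
              rw [hb]
              refine bit_congr ?_
              have e1 : j ≤ i ↔ j < i := by omega
              have e2 : i < j ↔ i ≤ j := by omega
              simp [e1, e2]
          · simpa [State.setCell, hba] using hb
        · simpa [State.setCell] using h1)
      ht hs (show o₁ = o₁ ∧ _ from ⟨rfl, by simpa using hrep, hF, h1⟩)
    refine ⟨σ₂, (hr.seq hr₂).mono (by simp [time]), ht₂, ?_, hF₂⟩
    refine ⟨hrep₂.size, hrep₂.index, hrep₂.row, hrep₂.bound, hrep₂.graph, fun b j hj => ?_⟩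
    rw [hrep₂.sets b j hj]
    by_cases hba : b = a
    · subst hba
      exact bit_congr (by simp [den, hS, hj])
    · simp [den, hba]
  | print φ =>
    intro k v σ m o hφ hσ h
    obtain ⟨σ₁, hr, ht, h1, ha, hF⟩ := φ.run_compile G m k v σ o hφ hσ h
    exact ⟨σ₁, (hr.seq (Run.print (e := .reg 1) ht h1)).mono (by simp [time]), ht,
      h.of_frame ha hF, hF⟩
  | emit =>
    intro k v σ m o hφ hσ h
    exact ⟨σ, (Run.emit hσ).mono (by simp [time]), hσ, h, Frame.refl k σ⟩
  | seq c d ih ih' =>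
    intro k v σ m o hc hσ h
    obtain ⟨σ₁, hr, ht, hrep, hF⟩ := ih k v σ m o hc.1 hσ h
    obtain ⟨σ₂, hr', ht', hrep', hF'⟩ := ih' k v σ₁ _ (c.den G k v (m, o)).2 hc.2 ht hrep
    exact ⟨σ₂, (hr.seq hr').mono (by simp [time]), ht', hrep', hF.trans hF' le_rfl⟩
  | when_ φ c ih =>
    intro k v σ m o hc hσ h
    obtain ⟨σ₁, hr, ht, h1, ha, hF⟩ := φ.run_compile G m k v σ o hc.1 hσ h
    by_cases hp : φ.Holds G m k v
    · obtain ⟨σ₂, hr', ht', hrep', hF'⟩ := ih k v σ₁ m o hc.2 ht (h.of_frame ha hF)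
      rw [den, if_pos hp]
      refine ⟨σ₂, (hr.seq (Run.branchTrue ht ?_ hr')).mono (by simp [time]), ht', hrep',
        hF.trans hF' le_rfl⟩
      simp [Exp.eval, h1, hp]
    · rw [den, if_neg hp]
      refine ⟨σ₁, (hr.seq (Run.branchFalse ht ?_ (.skip ht))).mono (by simp [time]), ht,
        h.of_frame ha hF, hF⟩
      simp [Exp.eval, h1, hp]
  | for_ c ih =>
    intro k v σ m o hc hσ h
    set D : ℕ → (ℕ → Set ℕ) × Output := fun i =>
      (List.range i).foldl (fun s i => c.den G (k + 1) (Function.update v k i) s) (m, o) with hD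
    obtain ⟨σ₁, o₁, hr, ⟨rfl, hrep, hF⟩, ht, hs⟩ := run_forLoop (n := n) (k := k)
      (T := c.time.eval n) (c := c.compile (k + 1))
      (I := fun i σ' o' => o' = (D i).2 ∧ Represents G k v (D i).1 σ' ∧ Frame k σ σ')
      (by
        rintro i σ' o' x u hx ⟨h1, h2, h3⟩
        exact ⟨h1, h2.of_frame rfl ((Frame.refl k σ').setReg (by omega)), h3.setReg (by omega)⟩)
      (by
        rintro i hi σ' o' ⟨rfl, hrep, hF⟩ hC
        obtain ⟨σ₁, hr, ht, hrep₁, hF₁⟩ := ih (k + 1) _ σ' (D i).1 (D i).2 hc hC.tame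
          (hrep.push hi hC)
        have hD' : D (i + 1) = c.den G (k + 1) (Function.update v k i) ((D i).1, (D i).2) := by
          simp [hD, List.range_succ]
        rw [← hD'] at hr hrep₁
        exact ⟨σ₁, _, hr, ⟨rfl, hrep₁.pop, hF.trans hF₁ (by omega)⟩, hrep₁.counter ht⟩)
      hσ h.size (show o = o ∧ _ from ⟨rfl, h, Frame.refl k σ⟩)
    exact ⟨σ₁, hr.mono (by simp [time]), ht, hrep, hF⟩

end Cmd

end RAM

/-! ### Maximal cliques and their codes -/

namespace CliqueCode

variable {R : ℕ → ℕ → Prop}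

/-- The set `K` is a maximal clique among the vertices below `n`, where `R` is the relation "equal
or adjacent". -/
structure MaxClique (R : ℕ → ℕ → Prop) (n : ℕ) (K : Set ℕ) : Prop where
  lt : ∀ u ∈ K, u < n
  clique : ∀ u ∈ K, ∀ w ∈ K, R u w
  max : ∀ u < n, u ∉ K → ∃ w ∈ K, ¬R u w

/-- From a maximal clique `K` on the vertices below `k` to a set of vertices below `k + 1`: if `k`
is joined to all of `K`, then `k` is added to `K`. Otherwise `β` decides whether `K` stays, or `k`
replaces the vertices of `K` to which it is not joined. -/
def step (R : ℕ → ℕ → Prop) (k : ℕ) (β : Prop) (K : Set ℕ) : Set ℕ :=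
  {i | (i ∈ K ∧ (β → R i k)) ∨ (i = k ∧ (β ∨ ∀ u ∈ K, R u k))}

/-- The conditions under which the bit at `k` may be set: `k` is not joined to all of `K`, and the
clique that consists of `k` and the neighbors of `k` in `K` is maximal on the vertices below
`k + 1`, and `K` is the lexicographically first maximal clique on the vertices below `k` that
contains these neighbors. The last two are combined into one condition on the vertices outside
`K`. -/
def CanFlip (R : ℕ → ℕ → Prop) (k : ℕ) (K : Set ℕ) : Prop :=
  (¬∀ u ∈ K, R u k) ∧ ∀ u < k, u ∉ K → ∃ w ∈ K, ¬R u w ∧ (R w k ∨ (w < u ∧ ¬R u k))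

/-- The set of vertices below `k` that is reached by the decisions in `b`. -/
def path (R : ℕ → ℕ → Prop) (b : Set ℕ) : ℕ → Set ℕ
  | 0 => ∅
  | k + 1 => step R k (k ∈ b) (path R b k)

/-- The codes of the maximal cliques on the vertices below `n`. -/
def Valid (R : ℕ → ℕ → Prop) (n : ℕ) (b : Set ℕ) : Prop :=
  ∀ k ∈ b, k < n ∧ CanFlip R k (path R b k)

theorem path_congr {b b' : Set ℕ} {k : ℕ} (h : ∀ j < k, j ∈ b ↔ j ∈ b') :
    path R b k = path R b' k := by
  induction k with
  | zero => rfl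
  | succ k ih =>
    rw [path, path, ih fun j hj => h j (by omega), propext (h k (by omega))]

theorem valid_empty (n : ℕ) : Valid R n ∅ := by simp [Valid]

theorem MaxClique.lt_of_mem_step {k : ℕ} {β : Prop} {K : Set ℕ} (h : MaxClique R k K) {u : ℕ}
    (hu : u ∈ step R k β K) : u < k + 1 := by
  rcases hu with hu | hu
  · have := h.lt u hu.1; omega
  · omega

theorem MaxClique.step (hr : ∀ i, R i i) (hs : ∀ i j, R i j → R j i)
    {k : ℕ} {β : Prop} {K : Set ℕ} (h : MaxClique R k K)
    (hβ : β → CanFlip R k K) : MaxClique R (k + 1) (step R k β K) := by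
  have hk : ∀ u ∈ CliqueCode.step R k β K, k ∈ CliqueCode.step R k β K → R u k := by
    intro u hu hk
    rcases hu with hu | hu
    · rcases hk with hk | hk
      · exact absurd (h.lt k hk.1) (by omega)
      · rcases hk.2 with hb | hf
        exacts [hu.2 hb, hf u hu.1]
    · rw [hu.1]; exact hr k
  refine ⟨fun u => h.lt_of_mem_step, fun u hu w hw => ?_, fun u hu huK => ?_⟩
  · by_cases hwk : w = k
    · subst hwk; exact hk u hu hw
    by_cases huk : u = k
    · subst huk; exact hs _ _ (hk w hw hu)
    · exact h.clique u (hu.resolve_right (fun H => huk H.1)).1 w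
        (hw.resolve_right (fun H => hwk H.1)).1
  · by_cases huk : u = k
    · subst huk
      have h1 : ¬β := fun hb => huK (.inr ⟨rfl, .inl hb⟩)
      have h2 : ¬∀ w ∈ K, R w u := fun H => huK (.inr ⟨rfl, .inr H⟩)
      push Not at h2
      obtain ⟨w, hw, hwu⟩ := h2
      exact ⟨w, .inl ⟨hw, fun hb => absurd hb h1⟩, fun H => hwu (hs _ _ H)⟩
    · have huk' : u < k := by omega
      by_cases hb : β
      · by_cases hR : R u k
        · have huK' : u ∉ K := fun H => huK (.inl ⟨H, fun _ => hR⟩)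
          obtain ⟨w, hw, hn, hor⟩ := (hβ hb).2 u huk' huK'
          refine ⟨w, .inl ⟨hw, fun _ => hor.resolve_right fun H => H.2 hR⟩, hn⟩
        · exact ⟨k, .inr ⟨rfl, .inl hb⟩, hR⟩
      · have huK' : u ∉ K := fun H => huK (.inl ⟨H, fun hb' => absurd hb' hb⟩)
        obtain ⟨w, hw, hn⟩ := h.max u huk' huK'
        exact ⟨w, .inl ⟨hw, fun hb' => absurd hb' hb⟩, hn⟩

theorem maxClique_path (hr : ∀ i, R i i) (hs : ∀ i j, R i j → R j i)
    {b : Set ℕ} {k : ℕ} (hb : ∀ j ∈ b, j < k → CanFlip R j (path R b j)) :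
    MaxClique R k (path R b k) := by
  induction k with
  | zero => exact ⟨by simp [path], by simp [path], by simp⟩
  | succ k ih =>
    exact (ih fun j hj hjk => hb j hj (by omega)).step hr hs fun h => hb k h (by omega)

/-- A maximal clique is determined by its trace on the neighborhood of `k` if it is the
lexicographically first one with this trace: at the smallest vertex on which two such cliques
differ, either of the two reasons to leave it out applies to both of them. -/
theorem MaxClique.eq_of_inter_eq {k : ℕ} {K K' : Set ℕ} (h : MaxClique R k K)
    (h' : MaxClique R k K')
    (hc : ∀ u < k, u ∉ K → ∃ w ∈ K, ¬R u w ∧ (R w k ∨ w < u))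
    (hc' : ∀ u < k, u ∉ K' → ∃ w ∈ K', ¬R u w ∧ (R w k ∨ w < u))
    (hK : ∀ u, R u k → (u ∈ K ↔ u ∈ K')) : K = K' := by
  ext u
  induction u using Nat.strong_induction_on with
  | _ u ih =>
    constructor
    · intro hu
      by_contra hu'
      obtain ⟨w, hw, hn, hw' | hw'⟩ := hc' u (h.lt u hu) hu'
      · exact hn (h.clique u hu w ((hK w hw').2 hw))
      · exact hn (h.clique u hu w ((ih w hw').2 hw))
    · intro hu
      by_contra hu'
      obtain ⟨w, hw, hn, hw' | hw'⟩ := hc u (h'.lt u hu) hu'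
      · exact hn (h'.clique u hu w ((hK w hw').1 hw))
      · exact hn (h'.clique u hu w ((ih w hw').1 hw))

theorem mem_step_self {k : ℕ} {β : Prop} {K : Set ℕ} (h : MaxClique R k K) :
    k ∈ step R k β K ↔ β ∨ ∀ u ∈ K, R u k := by
  have : k ∉ K := fun H => absurd (h.lt k H) (by omega)
  simp [step, this]

/-- Both the clique and the bit can be recovered after a step. -/
theorem step_injective {k : ℕ} {β β' : Prop} {K K' : Set ℕ} (h : MaxClique R k K)
    (h' : MaxClique R k K') (hβ : β → CanFlip R k K) (hβ' : β' → CanFlip R k K')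
    (he : step R k β K = step R k β' K') : K = K' ∧ (β ↔ β') := by
  have e := mem_step_self h (β := β)
  have e' := mem_step_self h' (β := β')
  have hne : ∀ u, u < k → ((u ∈ K ∧ (β → R u k)) ↔ (u ∈ K' ∧ (β' → R u k))) := by
    intro u hu
    have : u ∈ step R k β K ↔ u ∈ step R k β' K' := by rw [he]
    simpa [step, hu.ne] using this
  by_cases hk : k ∈ step R k β K
  · have h1 := e.1 hk
    have h1' := e'.1 (he ▸ hk)
    -- either `CanFlip` provides the witness, or `k` is joined to all of `K`, and maximality does
    have canon : ∀ {β : Prop} {K : Set ℕ}, MaxClique R k K → (β → CanFlip R k K) →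
        (β ∨ ∀ u ∈ K, R u k) → ∀ u < k, u ∉ K → ∃ w ∈ K, ¬R u w ∧ (R w k ∨ w < u) := by
      rintro β K h hβ (hb | hf) u hu huK
      · obtain ⟨w, hw, hn, hor⟩ := (hβ hb).2 u hu huK
        exact ⟨w, hw, hn, hor.imp id And.left⟩
      · obtain ⟨w, hw, hn⟩ := h.max u hu huK
        exact ⟨w, hw, hn, .inl (hf w hw)⟩
    have hKK : K = K' := by
      refine h.eq_of_inter_eq h' (canon h hβ h1) (canon h' hβ' h1') fun u huk => ?_
      by_cases hu : u < k
      · have := hne u hu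
        simpa [huk] using this
      · exact ⟨fun H => absurd (h.lt u H) hu, fun H => absurd (h'.lt u H) hu⟩
    subst hKK
    refine ⟨rfl, fun hb => h1'.resolve_right (hβ hb).1, fun hb => h1.resolve_right (hβ' hb).1⟩
  · have h1 := not_or.1 fun H => hk (e.2 H)
    have h1' := not_or.1 fun H => hk (he ▸ e'.2 H)
    refine ⟨?_, by simp [h1.1, h1'.1]⟩
    ext u
    by_cases hu : u < k
    · simpa [h1.1, h1'.1] using hne u hu
    · exact ⟨fun H => absurd (h.lt u H) hu, fun H => absurd (h'.lt u H) hu⟩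

theorem path_injective (hr : ∀ i, R i i) (hs : ∀ i j, R i j → R j i)
    {b b' : Set ℕ} {k : ℕ}
    (hb : ∀ j ∈ b, j < k → CanFlip R j (path R b j))
    (hb' : ∀ j ∈ b', j < k → CanFlip R j (path R b' j))
    (he : path R b k = path R b' k) : ∀ j < k, j ∈ b ↔ j ∈ b' := by
  induction k with
  | zero => simp
  | succ k ih =>
    have c := fun j hj hjk => hb j hj (Nat.lt_succ_of_lt hjk)
    have c' := fun j hj hjk => hb' j hj (Nat.lt_succ_of_lt hjk)
    obtain ⟨h1, h2⟩ := step_injective (maxClique_path hr hs c) (maxClique_path hr hs c')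
      (fun h => hb k h (by omega)) (fun h => hb' k h (by omega)) he
    intro j hj
    rcases Nat.lt_succ_iff_lt_or_eq.1 hj with hj | rfl
    exacts [ih c c' h1 j hj, h2]

theorem Valid.path_injective (hr : ∀ i, R i i) (hs : ∀ i j, R i j → R j i)
    {n : ℕ} {b b' : Set ℕ} (hb : Valid R n b) (hb' : Valid R n b')
    (he : path R b n = path R b' n) : b = b' := by
  have := CliqueCode.path_injective hr hs (fun j hj _ => (hb j hj).2)
    (fun j hj _ => (hb' j hj).2) he
  ext j
  by_cases hj : j < n
  · exact this j hj
  · exact ⟨fun H => absurd (hb j H).1 hj, fun H => absurd (hb' j H).1 hj⟩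

theorem Valid.maxClique (hr : ∀ i, R i i) (hs : ∀ i j, R i j → R j i)
    {n : ℕ} {b : Set ℕ} (hb : Valid R n b) : MaxClique R n (path R b n) :=
  maxClique_path hr hs fun j hj _ => (hb j hj).2

/-- The lexicographically first maximal clique on the vertices below `k` that contains the
clique `L`. -/
theorem exists_lexFirst (hr : ∀ i, R i i) (hs : ∀ i j, R i j → R j i)
    {k : ℕ} {L : Set ℕ} (hlt : ∀ u ∈ L, u < k)
    (hcl : ∀ u ∈ L, ∀ w ∈ L, R u w) : ∃ K, MaxClique R k K ∧ L ⊆ K ∧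
      ∀ u < k, u ∉ K → ∃ w ∈ K, ¬R u w ∧ (w ∈ L ∨ (w < u ∧ ∀ x ∈ L, R u x)) := by
  let P : ℕ → Prop := Nat.strongRec fun u ih =>
    u < k ∧ (∀ x ∈ L, R u x) ∧ ∀ w, ∀ h : w < u, ih w h → R u w
  have hP : ∀ u, P u ↔ u < k ∧ (∀ x ∈ L, R u x) ∧ ∀ w < u, P w → R u w := by
    intro u
    simp only [P]
    rw [Nat.strongRec_eq]
  have hLP : ∀ u ∈ L, P u := fun u hu =>
    (hP u).2 ⟨hlt u hu, hcl u hu, fun w _ hw => hs _ _ (((hP w).1 hw).2.1 u hu)⟩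
  have hclP : ∀ u, P u → ∀ w, P w → R u w := by
    intro u hu w hw
    rcases lt_trichotomy u w with h | rfl | h
    · exact hs _ _ (((hP w).1 hw).2.2 u h hu)
    · exact hr u
    · exact ((hP u).1 hu).2.2 w h hw
  have hmax : ∀ u < k, ¬P u → ∃ w, P w ∧ ¬R u w ∧ (w ∈ L ∨ (w < u ∧ ∀ x ∈ L, R u x)) := by
    intro u hu hPu
    by_cases hL : ∀ x ∈ L, R u x
    · have : ¬∀ w < u, P w → R u w := fun H => hPu ((hP u).2 ⟨hu, hL, H⟩)
      push Not at this
      obtain ⟨w, hw, hPw, hn⟩ := this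
      exact ⟨w, hPw, hn, .inr ⟨hw, hL⟩⟩
    · push Not at hL
      obtain ⟨w, hw, hn⟩ := hL
      exact ⟨w, hLP w hw, hn, .inl hw⟩
  refine ⟨{u | P u}, ⟨fun u hu => ((hP u).1 hu).1, hclP, fun u hu hPu => ?_⟩, hLP, hmax⟩
  obtain ⟨w, hw, hn, -⟩ := hmax u hu hPu
  exact ⟨w, hw, hn⟩

theorem MaxClique.exists_step (hr : ∀ i, R i i) (hs : ∀ i j, R i j → R j i)
    {k : ℕ} {L : Set ℕ} (h : MaxClique R (k + 1) L) :
    ∃ (K : Set ℕ) (β : Prop), MaxClique R k K ∧ (β → CanFlip R k K) ∧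
      CliqueCode.step R k β K = L := by
  by_cases hk : k ∈ L
  · obtain ⟨K, hK, hLK, hfirst⟩ := exists_lexFirst hr hs (k := k) (L := {u | u ∈ L ∧ u ≠ k})
      (fun u hu => by have := h.lt u hu.1; have := hu.2; omega)
      (fun u hu w hw => h.clique u hu.1 w hw.1)
    have hLk : ∀ u ∈ L, u ≠ k → u ∈ K := fun u hu huk => hLK ⟨hu, huk⟩
    have hKL : ∀ u ∈ K, R u k → u ∈ L := by
      intro u hu huk
      by_contra huL
      obtain ⟨w, hw, hn⟩ := h.max u (by have := hK.lt u hu; omega) huL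
      by_cases hwk : w = k
      · exact hn (hwk ▸ huk)
      · exact hn (hK.clique u hu w (hLk w hw hwk))
    refine ⟨K, ¬∀ u ∈ K, R u k, hK, fun hf => ⟨hf, fun u hu huK => ?_⟩, ?_⟩
    · by_cases huk : R u k
      · have huL : u ∉ L := fun H => huK (hLk u H (by omega))
        obtain ⟨w, hw, hn⟩ := h.max u (by omega) huL
        have hwk : w ≠ k := fun H => hn (H ▸ huk)
        exact ⟨w, hLk w hw hwk, hn, .inl (h.clique w hw k hk)⟩
      · obtain ⟨w, hw, hn, hor⟩ := hfirst u hu huK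
        exact ⟨w, hw, hn, hor.imp (fun H => h.clique w H.1 k hk) fun H => ⟨H.1, huk⟩⟩
    · ext u
      constructor
      · rintro (⟨hu, hR⟩ | ⟨rfl, -⟩)
        · by_cases hf : ∀ u ∈ K, R u k
          exacts [hKL u hu (hf u hu), hKL u hu (hR hf)]
        · exact hk
      · intro hu
        by_cases huk : u = k
        · exact .inr ⟨huk, (em _).symm⟩
        · exact .inl ⟨hLk u hu huk, fun _ => h.clique u hu k hk⟩
  · have hL : MaxClique R k L := by
      refine ⟨fun u hu => ?_, h.clique, fun u hu => h.max u (by omega)⟩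
      have := h.lt u hu
      have : u ≠ k := fun H => hk (H ▸ hu)
      omega
    obtain ⟨w, hw, hn⟩ := h.max k (by omega) hk
    refine ⟨L, False, hL, False.elim, ?_⟩
    ext u
    have : ¬∀ u ∈ L, R u k := fun H => hn (hs _ _ (H w hw))
    simp [CliqueCode.step, this]

theorem MaxClique.exists_valid (hr : ∀ i, R i i) (hs : ∀ i j, R i j → R j i)
    {n : ℕ} {L : Set ℕ} (h : MaxClique R n L) :
    ∃ b, Valid R n b ∧ path R b n = L := by
  induction n generalizing L with
  | zero =>
    refine ⟨∅, valid_empty 0, ?_⟩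
    ext u
    exact ⟨fun H => H.elim, fun H => absurd (h.lt u H) (by omega)⟩
  | succ n ih =>
    obtain ⟨K, β, hK, hβ, rfl⟩ := h.exists_step hr hs
    obtain ⟨b, hb, rfl⟩ := ih hK
    have hlt : ∀ k ≤ n, ∀ j < k, j ∈ {j | j ∈ b ∨ (j = n ∧ β)} ↔ j ∈ b := by
      intro k hk j hj
      simp [show j ≠ n by omega]
    have hn : n ∉ b := fun H => absurd (hb n H).1 (by omega)
    refine ⟨{j | j ∈ b ∨ (j = n ∧ β)}, ?_, ?_⟩
    · rintro k (hk | ⟨rfl, hk⟩)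
      · have := hb k hk
        rw [path_congr (hlt k this.1.le)]
        exact ⟨by omega, this.2⟩
      · rw [path_congr (hlt _ le_rfl)]
        exact ⟨by omega, hβ hk⟩
    · rw [path, path_congr (hlt n le_rfl)]
      simp [hn]

/-! ### The lexicographic order of the codes -/

/-- The binary number whose digits, the most significant one first, are the bits of `b`. -/
noncomputable def value (b : Set ℕ) : ℕ → ℕ
  | 0 => 0
  | k + 1 => 2 * value b k + RAM.bit (k ∈ b)

theorem value_lt (b : Set ℕ) (n : ℕ) : value b n < 2 ^ n := by
  induction n with
  | zero => simp [value]
  | succ n ih =>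
    have := RAM.bit_le_one (n ∈ b)
    rw [value, pow_succ]
    omega

theorem value_congr {b b' : Set ℕ} {k : ℕ} (h : ∀ j < k, j ∈ b ↔ j ∈ b') :
    value b k = value b' k := by
  induction k with
  | zero => rfl
  | succ k ih =>
    rw [value, value, ih fun j hj => h j (by omega), RAM.bit_congr (h k (by omega))]

theorem value_lt_value {b b' : Set ℕ} {k n : ℕ} (hkn : k < n) (h : ∀ j < k, j ∈ b ↔ j ∈ b')
    (hk : k ∉ b) (hk' : k ∈ b') : value b n < value b' n := by
  induction n with
  | zero => omega
  | succ n ih =>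
    rw [value, value]
    rcases Nat.lt_succ_iff_lt_or_eq.1 hkn with hlt | rfl
    · have := ih hlt
      have := RAM.bit_le_one (n ∈ b)
      omega
    · rw [value_congr h]
      simp [hk, hk']

theorem value_le_value {b b' : Set ℕ} {n : ℕ} (h : ∀ j < n, j ∈ b → j ∈ b') :
    value b n ≤ value b' n := by
  induction n with
  | zero => rfl
  | succ n ih =>
    have := ih fun j hj => h j (by omega)
    rw [value, value]
    by_cases hn : n ∈ b
    · have := h n (by omega) hn
      simp [*]
    · simp [hn]
      omega

theorem eq_or_exists_first_ne (b b' : Set ℕ) (n : ℕ) : (∀ j < n, j ∈ b ↔ j ∈ b') ∨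
    ∃ k < n, (∀ j < k, j ∈ b ↔ j ∈ b') ∧ ((k ∉ b ∧ k ∈ b') ∨ (k ∈ b ∧ k ∉ b')) := by
  induction n with
  | zero => simp
  | succ n ih =>
    rcases ih with h | ⟨k, hk, h⟩
    · by_cases hn : n ∈ b ↔ n ∈ b'
      · left
        intro j hj
        rcases Nat.lt_succ_iff_lt_or_eq.1 hj with hj | rfl
        exacts [h j hj, hn]
      · exact .inr ⟨n, by omega, h, by tauto⟩
    · exact .inr ⟨k, by omega, h⟩

theorem exists_first_ne_of_value_lt {b b' : Set ℕ} {n : ℕ} (h : value b n < value b' n) :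
    ∃ k < n, (∀ j < k, j ∈ b ↔ j ∈ b') ∧ k ∉ b ∧ k ∈ b' := by
  rcases eq_or_exists_first_ne b b' n with H | ⟨k, hk, hj, hor | hor⟩
  · exact absurd (value_congr H) h.ne
  · exact ⟨k, hk, hj, hor⟩
  · exact absurd (value_lt_value hk (fun j hj' => (hj j hj').symm) hor.2 hor.1) (by omega)

theorem Valid.eq_of_value_eq {n : ℕ} {b b' : Set ℕ} (hb : Valid R n b) (hb' : Valid R n b')
    (h : value b n = value b' n) : b = b' := by
  rcases eq_or_exists_first_ne b b' n with H | ⟨k, hk, hj, hor | hor⟩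
  · ext j
    by_cases hj : j < n
    · exact H j hj
    · exact ⟨fun H => absurd (hb j H).1 hj, fun H => absurd (hb' j H).1 hj⟩
  · exact absurd h (value_lt_value hk hj hor.1 hor.2).ne
  · exact absurd h (value_lt_value hk (fun j hj' => (hj j hj').symm) hor.2 hor.1).ne'

/-- The positions at which the code `b` may be increased. -/
def flips (R : ℕ → ℕ → Prop) (n : ℕ) (b : Set ℕ) : Set ℕ :=
  {k | k < n ∧ k ∉ b ∧ CanFlip R k (path R b k)}

/-- The next code: set the bit at the last possible position, and clear the bits after it. -/
def next (R : ℕ → ℕ → Prop) (n : ℕ) (b : Set ℕ) : Set ℕ :=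
  {i | ∃ k ∈ flips R n b, (∀ j ∈ flips R n b, j ≤ k) ∧ ((i < k ∧ i ∈ b) ∨ i = k)}

theorem exists_flip_of_value_lt {n : ℕ} {b b' : Set ℕ} (hb' : Valid R n b')
    (h : value b n < value b' n) :
    ∃ k ∈ flips R n b, (∀ j < k, j ∈ b ↔ j ∈ b') ∧ k ∈ b' := by
  obtain ⟨k, hk, hj, h1, h2⟩ := exists_first_ne_of_value_lt h
  refine ⟨k, ⟨hk, h1, ?_⟩, hj, h2⟩
  rw [path_congr hj]
  exact (hb' k h2).2

theorem exists_last_flip {n : ℕ} {b : Set ℕ} (h : (flips R n b).Nonempty) :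
    ∃ k ∈ flips R n b, (∀ j ∈ flips R n b, j ≤ k) ∧
      next R n b = {i | (i < k ∧ i ∈ b) ∨ i = k} := by
  have hfin : (flips R n b).Finite := (Set.finite_Iio n).subset fun k hk => hk.1
  obtain ⟨k, hk, hmax⟩ := Set.exists_max_image _ id hfin h
  refine ⟨k, hk, hmax, ?_⟩
  ext i
  constructor
  · rintro ⟨l, hl, hlm, hi⟩
    obtain rfl : l = k := le_antisymm (hmax l hl) (hlm k hk)
    exact hi
  · exact fun hi => ⟨k, hk, hmax, hi⟩

theorem Valid.next {n : ℕ} {b : Set ℕ} (hb : Valid R n b) (h : (flips R n b).Nonempty) :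
    Valid R n (next R n b) := by
  obtain ⟨k, hk, -, he⟩ := exists_last_flip h
  rw [he]
  have hagree : ∀ l ≤ k, ∀ j < l, j ∈ {i | (i < k ∧ i ∈ b) ∨ i = k} ↔ j ∈ b := by
    intro l hl j hj
    simp [show j < k by omega, show j ≠ k by omega]
  rintro j (⟨hj, hjb⟩ | rfl)
  · rw [path_congr (hagree j hj.le)]
    exact hb j hjb
  · rw [path_congr (hagree _ le_rfl)]
    exact ⟨hk.1, hk.2.2⟩

theorem value_lt_value_next {n : ℕ} {b : Set ℕ} (h : (flips R n b).Nonempty) :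
    value b n < value (next R n b) n := by
  obtain ⟨k, hk, -, he⟩ := exists_last_flip h
  rw [he]
  refine value_lt_value hk.1 (fun j hj => ?_) hk.2.1 (by simp)
  simp [hj, hj.ne]

/-- No valid code lies strictly between a code and the next one. -/
theorem value_next_le {n : ℕ} {b b' : Set ℕ} (hb' : Valid R n b')
    (h : value b n < value b' n) : value (next R n b) n ≤ value b' n := by
  obtain ⟨l, hl, hagree, hlb'⟩ := exists_flip_of_value_lt hb' h
  obtain ⟨k, hk, hmax, he⟩ := exists_last_flip ⟨l, hl⟩
  rw [he]
  rcases (hmax l hl).lt_or_eq with hlk | rfl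
  · refine (value_lt_value hl.1 (fun j hj => ?_) ?_ hlb').le
    · simp [← hagree j hj, show j < k by omega, show j ≠ k by omega]
    · simp [hl.2.1, hlk.ne]
  · refine value_le_value fun j hj => ?_
    rintro (⟨hjl, hjb⟩ | rfl)
    exacts [(hagree j hjl).1 hjb, hlb']

end CliqueCode

/-! ### Maximal split subgraphs and maximal cliques -/

namespace SimpleGraph

theorem IsSplit.compl {V : Type*} {G : SimpleGraph V} (h : G.IsSplit) : Gᶜ.IsSplit := by
  obtain ⟨K, hK, hI⟩ := h
  refine ⟨Kᶜ, (isClique_compl G).2 hI, ?_⟩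
  rw [compl_compl]
  exact (isIndepSet_compl G).2 hK

theorem isMinimalSplitCompletion_iff_compl {V : Type*} {G H : SimpleGraph V} :
    G.IsMinimalSplitCompletion H ↔ Gᶜ.IsMinimalSplitDeletion Hᶜ := by
  constructor
  · rintro ⟨⟨h1, h2⟩, h⟩
    refine ⟨⟨compl_le_compl h1, h2.compl⟩, fun H' hH' hle => ?_⟩
    have := h (y := H'ᶜ) ⟨le_compl_comm.1 hH'.1, hH'.2.compl⟩ (compl_le_of_compl_le hle)
    exact le_compl_comm.1 this
  · rintro ⟨⟨h1, h2⟩, h⟩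
    refine ⟨⟨compl_le_compl_iff_le.1 h1, by simpa using h2.compl⟩, fun H' hH' hle => ?_⟩
    exact compl_le_compl_iff_le.1 <|
      h (y := H'ᶜ) ⟨compl_le_compl hH'.1, hH'.2.compl⟩ (compl_le_compl hle)

variable {V : Type*} {C : SimpleGraph V} {K J : Set V}

/-- The subgraph of `C` that consists of the edges with at least one end in `K`. -/
def touching (C : SimpleGraph V) (K : Set V) : SimpleGraph V where
  Adj i j := C.Adj i j ∧ (i ∈ K ∨ j ∈ K)
  symm := ⟨fun _ _ h => ⟨h.1.symm, h.2.symm⟩⟩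
  loopless := ⟨fun _ h => h.1.ne rfl⟩

theorem touching_le (C : SimpleGraph V) (K : Set V) : C.touching K ≤ C := fun _ _ h => h.1

theorem IsClique.isSplit_touching (h : C.IsClique K) : (C.touching K).IsSplit :=
  ⟨K, fun _ ha _ hb hab => ⟨h ha hb hab, .inl ha⟩, fun _ ha _ hb _ H => H.2.elim ha hb⟩

theorem IsSplit.exists_le_touching [Finite V] {H : SimpleGraph V} (h : H.IsSplit) (hC : H ≤ C) :
    ∃ K, Maximal C.IsClique K ∧ H ≤ C.touching K := by
  obtain ⟨K, hK, hI⟩ := h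
  obtain ⟨J, hKJ, hJ⟩ := Set.Finite.exists_le_maximal (Set.toFinite {K | C.IsClique K})
    (hK.mono hC : C.IsClique K)
  refine ⟨J, hJ, fun a b hab => ⟨hC hab, ?_⟩⟩
  by_contra H
  rw [not_or] at H
  exact hI (fun h => H.1 (hKJ h)) (fun h => H.2 (hKJ h)) hab.ne hab

theorem exists_mem_notMem_of_maximal (hK : Maximal C.IsClique K) (hJ : Maximal C.IsClique J)
    (h : K ≠ J) : ∃ v ∈ K, v ∉ J := by
  by_contra! H
  exact h (hK.eq_of_subset hJ.prop H)

theorem mem_of_maximal (hK : Maximal C.IsClique K) {u : V} (h : ∀ w ∈ K, w ≠ u → C.Adj u w) :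
    u ∈ K := by
  have : C.IsClique (insert u K) :=
    hK.prop.insert fun w hw hne => h w hw hne.symm
  exact hK.le_of_ge this (Set.subset_insert u K) (Set.mem_insert u K)

/-- A maximal clique `K` is superfluous if it is the closed neighborhood of some vertex `v`, and
there is a vertex `w` outside `K` that is adjacent to all neighbors of `v`, and to others as well
unless `w < v`. In this case the split graph of `K` is not maximal, or it is also the split graph of
the closed neighborhood of `w`. -/
def Superfluous [LT V] (C : SimpleGraph V) (K : Set V) : Prop :=
  ∃ v ∈ K, (∀ x, C.Adj v x → x ∈ K) ∧ ∃ w ∉ K, (∀ x, C.Adj v x → C.Adj w x) ∧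
    (w < v ∨ ∃ x, C.Adj w x ∧ ¬C.Adj v x)

/-- If the edges that touch `K` also touch `J`, then `K` is the closed neighborhood of every vertex
`v` in `K \ J`, and the neighbors of `v` are also neighbors of every vertex in `J \ K`. -/
theorem neighbors_of_touching_le (hK : Maximal C.IsClique K) (hJ : Maximal C.IsClique J)
    (h : C.touching K ≤ C.touching J) {v w : V} (hv : v ∈ K) (hvJ : v ∉ J) (hw : w ∈ J)
    (hwK : w ∉ K) : (∀ x, C.Adj v x → x ∈ K) ∧ (∀ x, C.Adj v x → C.Adj w x) := by
  have hNJ : ∀ x, C.Adj v x → x ∈ J := fun x hx =>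
    (h (show (C.touching K).Adj v x from ⟨hx, .inl hv⟩)).2.resolve_left hvJ
  have hNK : ∀ x, C.Adj v x → x ∈ K := by
    intro x hx
    refine mem_of_maximal hK fun y hy hyx => ?_
    by_cases hyv : y = v
    · exact hyv ▸ hx.symm
    · exact hJ.prop (hNJ x hx) (hNJ y (hK.prop hv hy (Ne.symm hyv))) hyx.symm
  refine ⟨hNK, fun x hx => hJ.prop hw (hNJ x hx) ?_⟩
  rintro rfl
  exact hwK (hNK _ hx)

theorem lt_of_touching_le [LinearOrder V] (hK : Maximal C.IsClique K) (hJ : Maximal C.IsClique J)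
    (hKs : ¬C.Superfluous K) (h : C.touching K ≤ C.touching J) {v w : V} (hv : v ∈ K)
    (hvJ : v ∉ J) (hw : w ∈ J) (hwK : w ∉ K) :
    v < w ∧ ∀ x, C.Adj w x → C.Adj v x := by
  obtain ⟨h1, h2⟩ := neighbors_of_touching_le hK hJ h hv hvJ hw hwK
  have : ¬(w < v ∨ ∃ x, C.Adj w x ∧ ¬C.Adj v x) := fun H => hKs ⟨v, hv, h1, w, hwK, h2, H⟩
  push Not at this
  refine ⟨lt_of_le_of_ne this.1 ?_, this.2⟩
  rintro rfl
  exact hwK hv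

theorem touching_le_of_le [LinearOrder V] (hK : Maximal C.IsClique K)
    (hJ : Maximal C.IsClique J) (hKs : ¬C.Superfluous K) (h : C.touching K ≤ C.touching J) :
    C.touching J ≤ C.touching K := by
  by_cases hne : K = J
  · rw [hne]
  obtain ⟨v, hv, hvJ⟩ := exists_mem_notMem_of_maximal hK hJ hne
  have key : ∀ a b, C.Adj a b → a ∈ J → a ∈ K ∨ b ∈ K := by
    intro a b hab ha
    by_cases haK : a ∈ K
    · exact .inl haK
    · exact .inr ((neighbors_of_touching_le hK hJ h hv hvJ ha haK).1 b
        ((lt_of_touching_le hK hJ hKs h hv hvJ ha haK).2 b hab))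
  rintro a b ⟨hab, ha | hb⟩
  · exact ⟨hab, key a b hab ha⟩
  · exact ⟨hab, (key b a hab.symm hb).symm⟩

theorem touching_injective [LinearOrder V] (hK : Maximal C.IsClique K)
    (hJ : Maximal C.IsClique J) (hKs : ¬C.Superfluous K) (hJs : ¬C.Superfluous J)
    (h : C.touching K = C.touching J) : K = J := by
  by_contra hne
  obtain ⟨v, hv, hvJ⟩ := exists_mem_notMem_of_maximal hK hJ hne
  obtain ⟨w, hw, hwK⟩ := exists_mem_notMem_of_maximal hJ hK (Ne.symm hne)
  exact lt_asymm (lt_of_touching_le hK hJ hKs h.le hv hvJ hw hwK).1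
    (lt_of_touching_le hJ hK hJs h.ge hw hwK hv hvJ).1

theorem isMinimalSplitDeletion_touching [Finite V] [LinearOrder V] (hK : Maximal C.IsClique K)
    (hKs : ¬C.Superfluous K) : C.IsMinimalSplitDeletion (C.touching K) := by
  refine ⟨⟨touching_le C K, hK.prop.isSplit_touching⟩, fun H hH hle => ?_⟩
  obtain ⟨J, hJ, hHJ⟩ := hH.2.exists_le_touching hH.1
  exact hHJ.trans (touching_le_of_le hK hJ hKs (hle.trans hHJ))

/-- Among the maximal cliques that yield a given maximal split subgraph, some is not superfluous:
if `K` is superfluous because of `v` and `w`, then the closed neighborhood of `w` yields the same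
graph, and it can be superfluous only because of `w`, which is smaller than `v`. -/
theorem exists_not_superfluous [Finite V] [LinearOrder V] [WellFoundedLT V] {H : SimpleGraph V}
    (hH : C.IsMinimalSplitDeletion H) (hK : Maximal C.IsClique K) (hKH : C.touching K = H) :
    ∃ J, Maximal C.IsClique J ∧ ¬C.Superfluous J ∧ C.touching J = H := by
  by_contra! hall
  have key : ∀ v K, Maximal C.IsClique K → C.touching K = H → v ∈ K → (∀ x, C.Adj v x → x ∈ K) →
      ∀ w ∉ K, (∀ x, C.Adj v x → C.Adj w x) → (w < v ∨ ∃ x, C.Adj w x ∧ ¬C.Adj v x) → False := by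
    intro v
    induction v using WellFoundedLT.induction with
    | _ v ih =>
      intro K hK hKH hv hNv w hwK hvw hor
      have hcl : C.IsClique (insert w (C.neighborSet v)) :=
        IsClique.insert (hK.prop.subset hNv) fun x hx _ => hvw x hx
      obtain ⟨J, hle, hJ⟩ := Set.Finite.exists_le_maximal (Set.toFinite {K | C.IsClique K}) hcl
      have hwJ : w ∈ J := hle (Set.mem_insert _ _)
      have hNJ : ∀ x, C.Adj v x → x ∈ J := fun x hx => hle (Set.mem_insert_of_mem _ hx)
      have key' : ∀ a b, C.Adj a b → a ∈ K → a ∈ J ∨ b ∈ J := by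
        intro a b hab ha
        by_cases hav : a = v
        · exact .inr (hNJ b (hav ▸ hab))
        · exact .inl (hNJ a (hK.prop hv ha (Ne.symm hav)))
      have hKJ : C.touching K ≤ C.touching J := by
        rintro a b ⟨hab, ha | hb⟩
        · exact ⟨hab, key' a b hab ha⟩
        · exact ⟨hab, (key' b a hab.symm hb).symm⟩
      have hJH : C.touching J = H :=
        (hH.eq_of_le ⟨touching_le C J, hJ.prop.isSplit_touching⟩ (hKH ▸ hKJ)).symm
      have hwv : ∀ x, C.Adj w x → C.Adj v x := by
        intro x hx
        have : (C.touching K).Adj w x := by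
          rw [hKH, ← hJH]
          exact ⟨hx, .inl hwJ⟩
        have hxK := this.2.resolve_left hwK
        refine hK.prop hv hxK ?_
        rintro rfl
        exact hwK (hNv w hx.symm)
      have hlt : w < v := hor.resolve_right fun ⟨x, h1, h2⟩ => h2 (hwv x h1)
      have hJs : C.Superfluous J := by
        by_contra hJs
        exact hall J hJ hJs hJH
      obtain ⟨v', hv', hNv', w', hw', hvw', hor'⟩ := hJs
      have : v' = w := by
        by_contra hne
        have h1 : C.Adj v' w := hJ.prop hv' hwJ hne
        exact hw' (hNJ w' (hwv w' (hvw' w h1).symm))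
      subst this
      exact ih v' hlt J hJ hJH hv' hNv' w' hw' hvw' hor'
  have hKs : C.Superfluous K := by
    by_contra hKs
    exact hall K hK hKs hKH
  obtain ⟨v, hv, hNv, w, hw, hvw, hor⟩ := hKs
  exact key v K hK hKH hv hNv w hw hvw hor

theorem isMinimalSplitDeletion_iff [Finite V] [LinearOrder V] {H : SimpleGraph V} :
    C.IsMinimalSplitDeletion H ↔
      ∃ K, Maximal C.IsClique K ∧ ¬C.Superfluous K ∧ C.touching K = H := by
  constructor
  · intro hH
    obtain ⟨K, hK, hle⟩ := hH.prop.2.exists_le_touching hH.prop.1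
    exact exists_not_superfluous hH hK
      (hH.eq_of_le ⟨touching_le C K, hK.prop.isSplit_touching⟩ hle).symm
  · rintro ⟨K, hK, hKs, rfl⟩
    exact isMinimalSplitDeletion_touching hK hKs

end SimpleGraph

/-! ### Delay -/

namespace RAM

/-- A strengthening of a bound on the delay for induction over traces that consist of blocks of
length at most `T`, all but `r` of which complete a solution: it also bounds the time before the
first solution. -/
def BlockDelay (T r : ℕ) (τ : Trace) : Prop :=
  (∀ p, p <+: τ → (∀ s ∈ p, s.1 ≠ Action.emit) → p.length ≤ (r + 1) * T) ∧
    ∀ p, p <:+: τ → (∀ s ∈ p, s.1 ≠ Action.emit) → p.length ≤ (r + 2) * T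

theorem BlockDelay.of_length_le {T : ℕ} {τ : Trace} (h : τ.length ≤ T) : BlockDelay T 0 τ :=
  ⟨fun p hp _ => by have := hp.length_le; omega, fun p hp _ => by have := hp.length_le; omega⟩

theorem BlockDelay.append {T r r' : ℕ} {τ₁ τ₂ : Trace} (h₁ : τ₁.length ≤ T)
    (h₂ : BlockDelay T r τ₂) (hr : r ≤ r') (hr' : (∀ s ∈ τ₁, s.1 ≠ Action.emit) → r < r') :
    BlockDelay T r' (τ₁ ++ τ₂) := by
  have hpre : ∀ p, p <+: τ₁ ++ τ₂ → (∀ s ∈ p, s.1 ≠ Action.emit) → p.length ≤ (r' + 1) * T := by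
    intro p hp hne
    rcases List.prefix_or_prefix_of_prefix hp (List.prefix_append τ₁ τ₂) with hp | ⟨q, rfl⟩
    · have := hp.length_le
      nlinarith
    · have h1 := h₂.1 q ((List.prefix_append_right_inj τ₁).1 hp)
        fun s hs => hne s (List.mem_append_right _ hs)
      have h2 := hr' fun s hs => hne s (List.mem_append_left _ hs)
      rw [List.length_append]
      nlinarith
  refine ⟨hpre, fun p hp hne => ?_⟩
  rcases List.infix_append_iff.1 hp with hp | hp | ⟨q, q', rfl, hq, hq'⟩
  · have := hp.length_le
    nlinarith
  · have := h₂.2 p hp hne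
    nlinarith
  · have h1 := h₂.1 q' hq' fun s hs => hne s (List.mem_append_right _ hs)
    have h2 := hq.length_le
    rw [List.length_append]
    nlinarith

/-! ### The enumeration program -/

namespace Fm

/-- The vertices `x` and `y` are equal. -/
def eq (x y : ℕ) : Fm := and (not (lt x y)) (not (lt y x))

/-- Disjunction. -/
def or (φ ψ : Fm) : Fm := not (and (not φ) (not ψ))

/-- Implication. -/
def imp (φ ψ : Fm) : Fm := not (and φ (not ψ))

/-- Existential quantification. -/
def ex (φ : Fm) : Fm := not (all (not φ))

/-- Adjacency in the complement of the input graph, or in the input graph itself, according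
to `comp`. -/
def adj (comp : Bool) (x y : ℕ) : Fm :=
  match comp with
  | true => and (not (edge x y)) (not (eq x y))
  | false => edge x y

/-- The relation "equal or adjacent". -/
def rel (comp : Bool) (x y : ℕ) : Fm := or (eq x y) (adj comp x y)

end Fm

/-- Adjacency in the complement of `G`, or in `G` itself, according to `comp`. -/
def BaseAdj {n : ℕ} (comp : Bool) (G : SimpleGraph (Fin n)) (i j : ℕ) : Prop :=
  match comp with
  | true => ¬NatAdj G i j ∧ i ≠ j
  | false => NatAdj G i j

/-- Vertices are equal, or adjacent in the sense of `BaseAdj`. -/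
def BaseRel {n : ℕ} (comp : Bool) (G : SimpleGraph (Fin n)) (i j : ℕ) : Prop :=
  i = j ∨ BaseAdj comp G i j

section Holds

variable {n : ℕ} {G : SimpleGraph (Fin n)} {m : ℕ → Set ℕ} {φ ψ : Fm} {k x y : ℕ} {v : ℕ → ℕ}
  {comp : Bool}

theorem Fm.holds_eq : (Fm.eq x y).Holds G m k v ↔ v x = v y := by
  simp only [Fm.eq, Fm.Holds]; omega

theorem Fm.holds_or : (φ.or ψ).Holds G m k v ↔ φ.Holds G m k v ∨ ψ.Holds G m k v := by
  simp only [Fm.or, Fm.Holds]; tauto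

theorem Fm.holds_imp : (φ.imp ψ).Holds G m k v ↔ (φ.Holds G m k v → ψ.Holds G m k v) := by
  simp only [Fm.imp, Fm.Holds]; tauto

theorem Fm.holds_ex :
    φ.ex.Holds G m k v ↔ ∃ i < n, φ.Holds G m (k + 1) (Function.update v k i) := by
  simp only [Fm.ex, Fm.Holds]; push Not; rfl

theorem Fm.holds_adj : (Fm.adj comp x y).Holds G m k v ↔ BaseAdj comp G (v x) (v y) := by
  cases comp <;> simp [Fm.adj, BaseAdj, Fm.Holds, Fm.holds_eq]

theorem Fm.holds_rel : (Fm.rel comp x y).Holds G m k v ↔ BaseRel comp G (v x) (v y) := by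
  simp [Fm.rel, BaseRel, Fm.holds_or, Fm.holds_eq, Fm.holds_adj]

theorem Fm.scoped_eq : (Fm.eq x y).Scoped k ↔ x < k ∧ y < k := by
  simp only [Fm.eq, Fm.Scoped]; omega

theorem Fm.scoped_or : (φ.or ψ).Scoped k ↔ φ.Scoped k ∧ ψ.Scoped k := Iff.rfl

theorem Fm.scoped_imp : (φ.imp ψ).Scoped k ↔ φ.Scoped k ∧ ψ.Scoped k := Iff.rfl

theorem Fm.scoped_ex : φ.ex.Scoped k ↔ φ.Scoped (k + 1) := Iff.rfl

theorem Fm.scoped_adj : (Fm.adj comp x y).Scoped k ↔ x < k ∧ y < k := by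
  cases comp <;> simp [Fm.adj, Fm.Scoped, Fm.scoped_eq]

theorem Fm.scoped_rel : (Fm.rel comp x y).Scoped k ↔ x < k ∧ y < k := by
  simp [Fm.rel, Fm.scoped_or, Fm.scoped_eq, Fm.scoped_adj]

end Holds

theorem NatAdj.symm {n : ℕ} {G : SimpleGraph (Fin n)} {i j : ℕ} (h : NatAdj G i j) :
    NatAdj G j i := by
  obtain ⟨hi, hj, h⟩ := h
  exact ⟨hj, hi, h.symm⟩

theorem baseRel_refl {n : ℕ} (comp : Bool) (G : SimpleGraph (Fin n)) (i : ℕ) :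
    BaseRel comp G i i := .inl rfl

theorem baseRel_symm {n : ℕ} (comp : Bool) (G : SimpleGraph (Fin n)) (i j : ℕ)
    (h : BaseRel comp G i j) : BaseRel comp G j i := by
  rcases h with h | h
  · exact .inl h.symm
  · refine .inr ?_
    cases comp
    · exact NatAdj.symm h
    · exact ⟨fun H => h.1 H.symm, h.2.symm⟩

/-- The set variable that holds the current code. -/
abbrev codeVar : ℕ := 0

/-- The set variable that holds the current clique. -/
abbrev cliqueVar : ℕ := 1

/-- The set variable that holds the positions at which the current code may be increased. -/
abbrev flipsVar : ℕ := 2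

open Fm Cmd

/-- All vertices of the current clique are joined to vertex variable `0`; at depth `2`. -/
def joinedFm (comp : Bool) : Fm := all (imp (mem cliqueVar 2) (rel comp 2 0))

/-- `CliqueCode.CanFlip` for vertex variable `0` and the current clique; at depth `2`. -/
def canFlipFm (comp : Bool) : Fm :=
  and (not (joinedFm comp)) <| all <| imp (lt 2 0) <| imp (not (mem cliqueVar 2)) <| ex <|
    and (mem cliqueVar 3) <| and (not (rel comp 2 3)) <|
      or (rel comp 3 0) (and (lt 3 2) (not (rel comp 2 0)))

/-- `CliqueCode.step`, from the current clique at vertex variable `0`; at depth `2`, for vertex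
variable `1`. -/
def stepFm (comp : Bool) : Fm :=
  or (and (mem cliqueVar 1) (imp (mem codeVar 0) (rel comp 1 0)))
    (and (eq 1 0) (or (mem codeVar 0) (joinedFm comp)))

/-- Decoding: compute the clique and the possible flips of the current code. -/
def decodeCmd (comp : Bool) : Cmd :=
  .seq (.seq (.set cliqueVar (lt 0 0)) (.set flipsVar (lt 0 0))) <|
    .for_ <| .seq
      (.set flipsVar (or (mem flipsVar 1) (and (eq 1 0) (and (not (mem codeVar 0))
        (canFlipFm comp)))))
      (.set cliqueVar (stepFm comp))

/-- `CliqueCode.next` for the current code; at depth `1`, for vertex variable `0`. -/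
def nextFm : Fm :=
  ex <| and (mem flipsVar 1) <| and (all (imp (mem flipsVar 2) (not (lt 1 2)))) <|
    or (and (lt 0 1) (mem codeVar 0)) (eq 0 1)

/-- The current clique is superfluous; at depth `0`. -/
def superfluousFm (comp : Bool) : Fm :=
  ex <| and (mem cliqueVar 0) <| and (all (imp (adj comp 0 1) (mem cliqueVar 1))) <| ex <|
    and (not (mem cliqueVar 1)) <| and (all (imp (adj comp 0 2) (adj comp 1 2))) <|
      or (lt 1 0) (ex (and (adj comp 1 2) (not (adj comp 0 2))))

/-- Adjacency of vertex variables `0` and `1` in the graph of the edges that touch the current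
clique. -/
def touchingFm (comp : Bool) : Fm := and (adj comp 0 1) (or (mem cliqueVar 0) (mem cliqueVar 1))

/-- Adjacency of vertex variables `0` and `1` in the solution that belongs to the current clique. -/
def solutionFm (comp : Bool) : Fm :=
  match comp with
  | true => and (not (touchingFm true)) (not (eq 0 1))
  | false => touchingFm false

/-- Output of the solution that belongs to the current clique. -/
def outputCmd (comp : Bool) : Cmd :=
  .when_ (not (superfluousFm comp)) (.seq (.for_ (.for_ (.print (solutionFm comp)))) .emit)

/-- One round: decode the current code, output its solution, and pass to the next code. -/
def roundCmd (comp : Bool) : Cmd :=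
  .seq (decodeCmd comp) (.seq (outputCmd comp) (.set codeVar nextFm))

/-- There is a next code; at depth `0`. -/
def moreFm : Fm := ex (mem flipsVar 0)

/-- Rounds for all codes, from the empty one on. -/
def enumLoop (comp : Bool) : Prog :=
  .loop (.reg 1) (.seq ((roundCmd comp).compile 0) (moreFm.compile 0))

/-- The enumeration of the minimal split completions (`comp = true`) or deletions
(`comp = false`). -/
def enumProg (comp : Bool) : Prog := .seq (.assign 1 (.const 1)) (enumLoop comp)

/-- A bound on the length of a round. -/
noncomputable def roundTime (comp : Bool) : Polynomial ℕ :=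
  (roundCmd comp).time + moreFm.time + 1

theorem scoped_roundCmd (comp : Bool) : (roundCmd comp).Scoped 0 := by
  cases comp <;>
  simp [roundCmd, decodeCmd, outputCmd, solutionFm, touchingFm, superfluousFm, nextFm, stepFm,
    canFlipFm, joinedFm, Cmd.Scoped, Fm.Scoped, scoped_or, scoped_imp, scoped_ex, scoped_eq,
    scoped_adj, scoped_rel]

theorem scoped_moreFm : moreFm.Scoped 0 := by
  simp [moreFm, Fm.Scoped, scoped_ex]

/-! ### Correctness of a round -/

open CliqueCode

variable {n : ℕ}

/-- The vertices in a set of natural numbers. -/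
def verts (n : ℕ) (K : Set ℕ) : Set (Fin n) := {i | (i : ℕ) ∈ K}

/-- The graph whose maximal split subgraphs are looked for. -/
def base (comp : Bool) (G : SimpleGraph (Fin n)) : SimpleGraph (Fin n) :=
  match comp with
  | true => Gᶜ
  | false => G

/-- The clique with code `b`. -/
def cliqueOf (comp : Bool) (G : SimpleGraph (Fin n)) (b : Set ℕ) : Set (Fin n) :=
  verts n (path (BaseRel comp G) b n)

/-- The solution that is obtained from a clique. -/
def solutionOf (comp : Bool) (G : SimpleGraph (Fin n)) (K : Set (Fin n)) : SimpleGraph (Fin n) :=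
  base comp ((base comp G).touching K)

theorem baseAdj_iff {comp : Bool} {G : SimpleGraph (Fin n)} (i j : Fin n) :
    BaseAdj comp G i j ↔ (base comp G).Adj i j := by
  cases comp <;> simp [BaseAdj, base, NatAdj, Fin.ext_iff, and_comm]

theorem holds_joinedFm {comp : Bool} {G : SimpleGraph (Fin n)} {m : ℕ → Set ℕ} {v : ℕ → ℕ}
    (hm : ∀ u ∈ m cliqueVar, u < n) :
    (joinedFm comp).Holds G m 2 v ↔ ∀ u ∈ m cliqueVar, BaseRel comp G u (v 0) := by
  simp only [joinedFm, Fm.Holds, holds_imp, holds_rel]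
  exact ⟨fun H u hu => by simpa using H u (hm u hu) (by simpa using hu),
    fun H u _ hu => by simpa using H u (by simpa using hu)⟩

theorem holds_canFlipFm {comp : Bool} {G : SimpleGraph (Fin n)} {m : ℕ → Set ℕ} {v : ℕ → ℕ}
    (hm : ∀ u ∈ m cliqueVar, u < n) (hv : v 0 < n) :
    (canFlipFm comp).Holds G m 2 v ↔ CanFlip (BaseRel comp G) (v 0) (m cliqueVar) := by
  have h0 := holds_joinedFm (comp := comp) (G := G) (v := v) hm
  have : (canFlipFm comp).Holds G m 2 v ↔ (¬∀ u ∈ m cliqueVar, BaseRel comp G u (v 0)) ∧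
      ∀ u < n, u < v 0 → u ∉ m cliqueVar → ∃ w < n, w ∈ m cliqueVar ∧ ¬BaseRel comp G u w ∧
        (BaseRel comp G w (v 0) ∨ (w < u ∧ ¬BaseRel comp G u (v 0))) := by
    simp only [canFlipFm, Fm.Holds, holds_imp, holds_rel, holds_or, holds_ex, h0]
    simp
  rw [this]
  refine and_congr Iff.rfl ⟨fun H u hu huK => ?_, fun H u _ hu huK => ?_⟩
  · obtain ⟨w, -, hw⟩ := H u (by omega) hu huK
    exact ⟨w, hw⟩
  · obtain ⟨w, hw, hw'⟩ := H u hu huK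
    exact ⟨w, hm w hw, hw, hw'⟩

theorem holds_stepFm {comp : Bool} {G : SimpleGraph (Fin n)} {m : ℕ → Set ℕ} {v : ℕ → ℕ}
    (hm : ∀ u ∈ m cliqueVar, u < n) : (stepFm comp).Holds G m 2 v ↔
      v 1 ∈ step (BaseRel comp G) (v 0) (v 0 ∈ m codeVar) (m cliqueVar) := by
  simp only [stepFm, Fm.Holds, holds_imp, holds_rel, holds_or, holds_eq, holds_joinedFm hm, step,
    Set.mem_ofPred_eq]

theorem den_decodeCmd (comp : Bool) (G : SimpleGraph (Fin n)) {b : Set ℕ}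
    (hb : Valid (BaseRel comp G) n b) (m : ℕ → Set ℕ) (hm : m codeVar = b) (v : ℕ → ℕ)
    (o : Output) : ∃ m', (decodeCmd comp).den G 0 v (m, o) = (m', o) ∧ m' codeVar = b ∧
      m' cliqueVar = path (BaseRel comp G) b n ∧ m' flipsVar = flips (BaseRel comp G) n b := by
  set R := BaseRel comp G with hR
  obtain ⟨m₀, h₀, hm₀⟩ : ∃ m₀ : ℕ → Set ℕ, (Cmd.seq (.set cliqueVar (lt 0 0))
      (.set flipsVar (lt 0 0))).den G 0 v (m, o) = (m₀, o) ∧ m₀ codeVar = b ∧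
      m₀ cliqueVar = ∅ ∧ m₀ flipsVar = ∅ := by
    refine ⟨_, rfl, ?_⟩
    simp [Cmd.den, Fm.Holds, hm]
  have key : ∀ j ≤ n, ∃ m', (List.range j).foldl (fun s i => (Cmd.seq
      (.set flipsVar (or (mem flipsVar 1) (and (eq 1 0) (and (not (mem codeVar 0))
        (canFlipFm comp)))))
      (.set cliqueVar (stepFm comp))).den G (0 + 1) (Function.update v 0 i) s) (m₀, o) = (m', o) ∧
      m' codeVar = b ∧ m' cliqueVar = path R b j ∧ m' flipsVar = {i | i < j ∧ i ∈ flips R n b} := by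
    intro j
    induction j with
    | zero =>
      intro _
      exact ⟨m₀, by simp, hm₀.1, by simpa [path] using hm₀.2.1, by simpa using hm₀.2.2⟩
    | succ j ih =>
      intro hj
      obtain ⟨m', he, h1, h2, h3⟩ := ih (by omega)
      have hK : MaxClique R j (path R b j) :=
        maxClique_path (baseRel_refl comp G) (baseRel_symm comp G) fun i hi _ => (hb i hi).2
      have hlt : ∀ u ∈ path R b j, u < n := fun u hu => (hK.lt u hu).trans (by omega)
      rw [List.range_succ, List.foldl_append, he]
      refine ⟨_, rfl, ?_, ?_, ?_⟩
      · simpa [Cmd.den] using h1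
      · ext i
        have hw0 : Function.update (Function.update v 0 j) (0 + 1) i 0 = j := by simp
        have hw1 : Function.update (Function.update v 0 j) (0 + 1) i 1 = i := by simp
        simp only [Cmd.den, Function.update_self, Set.mem_ofPred_eq]
        rw [holds_stepFm (by simpa [h2] using hlt), hw0, hw1,
          Function.update_of_ne (by decide), Function.update_of_ne (by decide), h1, h2]
        refine ⟨fun H => H.2, fun H => ⟨?_, H⟩⟩
        have := hK.lt_of_mem_step H
        omega
      · ext i
        have hw0 : Function.update (Function.update v 0 j) (0 + 1) i 0 = j := by simp
        have hw1 : Function.update (Function.update v 0 j) (0 + 1) i 1 = i := by simp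
        simp only [Cmd.den]
        rw [Function.update_of_ne (by decide), Function.update_self]
        simp only [holds_or, Fm.Holds, holds_eq, Set.mem_ofPred_eq]
        rw [holds_canFlipFm (by simpa [h2] using hlt) (by rw [hw0]; omega), hw0, hw1, h1, h2, h3]
        constructor
        · rintro ⟨hi, h | ⟨rfl, h⟩⟩
          · exact ⟨Nat.lt_succ_of_lt h.1, h.2⟩
          · exact ⟨Nat.lt_succ_self _, hi, h⟩
        · rintro ⟨hi, h⟩
          rcases Nat.lt_succ_iff_lt_or_eq.1 hi with hi | rfl
          · exact ⟨h.1, .inl ⟨hi, h⟩⟩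
          · exact ⟨h.1, .inr ⟨rfl, h.2⟩⟩
  obtain ⟨m', he, h1, h2, h3⟩ := key n le_rfl
  refine ⟨m', ?_, h1, h2, ?_⟩
  · rw [decodeCmd, Cmd.den, h₀, Cmd.den, he]
  · rw [h3]
    ext i
    exact ⟨fun H => H.2, fun H => ⟨H.1, H⟩⟩

theorem encode_eq (H : SimpleGraph (Fin n)) : encode H =
    (List.range n).flatMap fun i => (List.range n).map fun j => bit (NatAdj H i j) := by
  have key : ∀ l, (List.range (l * n)).map (adjBit H) =
      (List.range l).flatMap fun i => (List.range n).map fun j => bit (NatAdj H i j) := by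
    intro l
    induction l with
    | zero => simp
    | succ l ih =>
      rw [Nat.add_mul, Nat.one_mul, List.range_add, List.map_append, ih, List.range_succ,
        List.flatMap_append]
      congr 1
      simp only [List.map_map, List.flatMap_cons, List.flatMap_nil, List.append_nil]
      refine List.map_congr_left fun j hj => ?_
      exact adjBit_eq H (List.mem_range.1 hj)
  exact key n

theorem den_for_print (G : SimpleGraph (Fin n)) (φ : Fm) (m : ℕ → Set ℕ) (v : ℕ → ℕ)
    (o : Output) : (Cmd.for_ (.for_ (.print φ))).den G 0 v (m, o) = (m, o.1, o.2 ++
      (List.range n).flatMap fun i => (List.range n).map fun j =>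
        bit (φ.Holds G m 2 (Function.update (Function.update v 0 i) 1 j))) := by
  have fold : ∀ (F : (ℕ → Set ℕ) → ℕ → List ℕ) (l : List ℕ) (s : (ℕ → Set ℕ) × Output),
      l.foldl (fun s i => (s.1, s.2.1, s.2.2 ++ F s.1 i)) s =
        (s.1, s.2.1, s.2.2 ++ l.flatMap (F s.1)) := by
    intro F l
    induction l with
    | nil => simp
    | cons a l ih => intro s; simp [ih]
  have inner : ∀ (s : (ℕ → Set ℕ) × Output) (w : ℕ → ℕ), (Cmd.for_ (.print φ)).den G 1 w s =
      (s.1, s.2.1, s.2.2 ++ (List.range n).map fun j =>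
        bit (φ.Holds G s.1 2 (Function.update w 1 j))) := by
    intro s w
    have := fold (fun m j => [bit (φ.Holds G m 2 (Function.update w 1 j))]) (List.range n) s
    rwa [← List.map_eq_flatMap] at this
  rw [Cmd.den]
  simp only [Nat.zero_add, inner]
  exact fold (fun m i => (List.range n).map fun j =>
    bit (φ.Holds G m 2 (Function.update (Function.update v 0 i) 1 j))) (List.range n) (m, o)

theorem holds_superfluousFm {comp : Bool} {G : SimpleGraph (Fin n)} {m : ℕ → Set ℕ}
    {v : ℕ → ℕ} : (superfluousFm comp).Holds G m 0 v ↔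
      (base comp G).Superfluous (verts n (m cliqueVar)) := by
  simp only [superfluousFm, Fm.Holds, holds_imp, holds_or, holds_ex, holds_adj]
  simp only [SimpleGraph.Superfluous, Fin.exists_iff, Fin.forall_iff, verts, ← baseAdj_iff]
  simp [Fin.lt_def, and_left_comm]

theorem holds_solutionFm {comp : Bool} {G : SimpleGraph (Fin n)} {m : ℕ → Set ℕ}
    {v : ℕ → ℕ} (h0 : v 0 < n) (h1 : v 1 < n) : (solutionFm comp).Holds G m 2 v ↔
      NatAdj (solutionOf comp G (verts n (m cliqueVar))) (v 0) (v 1) := by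
  have ht : (touchingFm comp).Holds G m 2 v ↔
      ((base comp G).touching (verts n (m cliqueVar))).Adj ⟨v 0, h0⟩ ⟨v 1, h1⟩ := by
    simp [touchingFm, Fm.Holds, holds_or, holds_adj, SimpleGraph.touching, verts, ← baseAdj_iff]
  cases comp
  · simpa [solutionFm, NatAdj, h0, h1, solutionOf, base] using ht
  · simp [solutionFm, NatAdj, h0, h1, solutionOf, base, Fm.Holds, holds_eq, ht, and_comm]

theorem den_outputCmd (comp : Bool) (G : SimpleGraph (Fin n)) (m : ℕ → Set ℕ) (v : ℕ → ℕ)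
    (L : List (List ℕ)) : (outputCmd comp).den G 0 v (m, L, []) = (m, open Classical in
      if (base comp G).Superfluous (verts n (m cliqueVar)) then (L, [])
      else (L ++ [encode (solutionOf comp G (verts n (m cliqueVar)))], [])) := by
  have hs : (Fm.not (superfluousFm comp)).Holds G m 0 v ↔
      ¬(base comp G).Superfluous (verts n (m cliqueVar)) := not_congr holds_superfluousFm
  rw [outputCmd, Cmd.den]
  by_cases h : (base comp G).Superfluous (verts n (m cliqueVar))
  · rw [if_neg (fun H => hs.1 H h), if_pos h]
  · rw [if_pos (hs.2 h), if_neg h, Cmd.den, den_for_print, Cmd.den, encode_eq]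
    simp only [List.nil_append]
    congr 4
    refine List.flatMap_congr fun i hi => List.map_congr_left fun j hj => bit_congr ?_
    rw [holds_solutionFm (by simpa using hi) (by simpa using hj)]
    simp

theorem den_roundCmd (comp : Bool) (G : SimpleGraph (Fin n)) {b : Set ℕ}
    (hb : Valid (BaseRel comp G) n b) (m : ℕ → Set ℕ) (hm : m codeVar = b) (v : ℕ → ℕ)
    (L : List (List ℕ)) : ∃ m', (roundCmd comp).den G 0 v (m, L, []) = (m', open Classical in
      if (base comp G).Superfluous (cliqueOf comp G b) then (L, [])
      else (L ++ [encode (solutionOf comp G (cliqueOf comp G b))], [])) ∧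
      m' codeVar = next (BaseRel comp G) n b ∧ m' flipsVar = flips (BaseRel comp G) n b := by
  obtain ⟨m₁, h, h0, h1, h2⟩ := den_decodeCmd comp G hb m hm v (L, [])
  rw [roundCmd, Cmd.den, h, Cmd.den, den_outputCmd, Cmd.den, h1]
  refine ⟨_, rfl, ?_, by simpa using h2⟩
  rw [Function.update_self]
  ext i
  simp only [nextFm, Fm.Holds, holds_ex, holds_imp, holds_or, holds_eq, next, Set.mem_ofPred_eq]
  simp [h0, h2]
  constructor
  · rintro ⟨hi, k, hk, hkf, hmax, hor⟩
    exact ⟨k, hkf, fun j hj => hmax j hj.1 hj, hor⟩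
  · rintro ⟨k, hkf, hmax, hor⟩
    have hk : k < n := hkf.1
    exact ⟨by omega, k, hk, hkf, fun j _ hj => hmax j hj, hor⟩

theorem holds_moreFm {G : SimpleGraph (Fin n)} {m : ℕ → Set ℕ} {v : ℕ → ℕ} {R : ℕ → ℕ → Prop}
    {b : Set ℕ} (hm : m flipsVar = flips R n b) :
    moreFm.Holds G m 0 v ↔ (flips R n b).Nonempty := by
  simp only [moreFm, Fm.Holds, holds_ex]
  simp only [Function.update_self, hm]
  exact ⟨fun ⟨i, _, hi⟩ => ⟨i, hi⟩, fun ⟨i, hi⟩ => ⟨i, hi.1, hi⟩⟩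

/-! ### Correctness and delay of the enumeration -/

/-- The solutions for the codes in `l`, in order, those for superfluous cliques left out. -/
noncomputable def solutionsOf (comp : Bool) (G : SimpleGraph (Fin n)) (l : List (Set ℕ)) :
    List (SimpleGraph (Fin n)) :=
  open Classical in (l.filter fun b => ¬(base comp G).Superfluous (cliqueOf comp G b)).map
    fun b => solutionOf comp G (cliqueOf comp G b)

/-- The number of codes of superfluous cliques in `l`. -/
noncomputable def superfluousCount (comp : Bool) (G : SimpleGraph (Fin n)) (l : List (Set ℕ)) : ℕ :=
  open Classical in (l.filter fun b => (base comp G).Superfluous (cliqueOf comp G b)).length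

/-- The loop, started at a valid code `b`, goes through the valid codes from `b` on. -/
theorem exec_enumLoop (comp : Bool) (G : SimpleGraph (Fin n)) (d : ℕ) :
    ∀ (b : Set ℕ) (m : ℕ → Set ℕ) (σ : State) (S : List (List ℕ)),
      2 ^ n - value b n = d → Valid (BaseRel comp G) n b → m codeVar = b → σ.Tame n →
      σ.reg 1 ≠ 0 → Represents G 0 (fun _ => 0) m σ →
      ∃ (τ : Trace) (σ' : State) (l : List (Set ℕ)), Exec (enumLoop comp) σ τ σ' ∧
        (∀ s ∈ τ, s.2.Tame n) ∧ l.Nodup ∧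
        (∀ b', b' ∈ l ↔ Valid (BaseRel comp G) n b' ∧ value b n ≤ value b' n) ∧
        (outcome (S, []) τ).1 = S ++ (solutionsOf comp G l).map encode ∧
        BlockDelay ((roundTime comp).eval n) (superfluousCount comp G l) τ := by
  induction d using Nat.strong_induction_on with
  | _ d ih =>
    intro b m σ S hd hb hm hσ h1 hrep
    set R := BaseRel comp G
    set v : ℕ → ℕ := fun _ => 0
    obtain ⟨σ₁, hr, ht₁, hrep₁, -⟩ := (roundCmd comp).run_compile G 0 v σ m (S, [])
      (scoped_roundCmd comp) hσ hrep
    obtain ⟨m', hden, hm0, hm2⟩ := den_roundCmd comp G hb m hm v S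
    rw [hden] at hr hrep₁
    obtain ⟨σ₂, hr', ht₂, hreg, ha₂, hF₂⟩ := moreFm.run_compile G m' 0 v σ₁ _
      scoped_moreFm ht₁ hrep₁
    have hrep₂ : Represents G 0 v m' σ₂ := hrep₁.of_frame ha₂ hF₂
    rw [bit_congr (holds_moreFm hm2)] at hreg
    obtain ⟨τ₁, hex, hlen, htame, hout⟩ := hr.seq hr'
    have htame' : ∀ s ∈ (Action.silent, σ) :: τ₁, s.2.Tame n := by simpa [hσ] using htame
    have hlen' : ((Action.silent, σ) :: τ₁).length ≤ (roundTime comp).eval n := by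
      simpa [roundTime] using hlen
    have hT : 1 ≤ (roundTime comp).eval n := by simp [roundTime]
    -- what the remaining rounds do
    obtain ⟨τ₂, σ', l, hex₂, htame₂, hnd, hmem, hout₂, hdelay⟩ : ∃ (τ₂ : Trace) (σ' : State)
        (l : List (Set ℕ)), Exec (enumLoop comp) σ₂ τ₂ σ' ∧ (∀ s ∈ τ₂, s.2.Tame n) ∧ l.Nodup ∧
        (∀ b', b' ∈ l ↔ Valid R n b' ∧ value b n < value b' n) ∧
        (∀ S', (outcome (S', []) τ₂).1 = S' ++ (solutionsOf comp G l).map encode) ∧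
        BlockDelay ((roundTime comp).eval n) (superfluousCount comp G l) τ₂ := by
      by_cases hne : (flips R n b).Nonempty
      · rw [bit_of_true hne] at hreg
        have hlt := value_lt_value_next hne
        have hlt' := value_lt (next R n b) n
        obtain ⟨τ₂, σ', l, g1, g2, g3, g4, g5, g6⟩ := ih (2 ^ n - value (next R n b) n) (by omega)
          (next R n b) m' σ₂ S rfl (hb.next hne) hm0 ht₂ (by omega) hrep₂
        refine ⟨τ₂, σ', l, g1, g2, g3, fun b' => (g4 b').trans (and_congr_right fun hb' => ?_),
          fun S' => ?_, g6⟩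
        · exact ⟨fun H => by omega, fun H => value_next_le hb' H⟩
        · rw [outcome_fst] at g5 ⊢
          rw [List.append_cancel_left g5]
      · rw [bit_of_false hne] at hreg
        refine ⟨[(.silent, σ₂)], σ₂, [], .loopFalse hreg, by simpa using ht₂, by simp, ?_, ?_,
          .of_length_le hT⟩
        · intro b'
          simp only [List.not_mem_nil, false_iff]
          rintro ⟨hb', hlt⟩
          obtain ⟨k, hk, -⟩ := exists_flip_of_value_lt hb' hlt
          exact hne ⟨k, hk⟩
        · simp [outcome, solutionsOf]
    refine ⟨((.silent, σ) :: τ₁) ++ τ₂, σ', b :: l, .loopTrue h1 hex hex₂, ?_, ?_, ?_, ?_, ?_⟩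
    · intro s hs
      rcases List.mem_append.1 hs with hs | hs
      exacts [htame' s hs, htame₂ s hs]
    · refine List.nodup_cons.2 ⟨fun H => ?_, hnd⟩
      exact absurd ((hmem b).1 H).2 (lt_irrefl _)
    · intro b'
      rw [List.mem_cons, hmem]
      constructor
      · rintro (rfl | ⟨h, h'⟩)
        exacts [⟨hb, le_rfl⟩, ⟨h, h'.le⟩]
      · rintro ⟨h, h'⟩
        rcases h'.lt_or_eq with h' | h'
        exacts [.inr ⟨h, h'⟩, .inl (hb.eq_of_value_eq h h').symm]
    · have : outcome (S, []) ((.silent, σ) :: τ₁) = outcome (S, []) τ₁ := rfl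
      rw [outcome_append, this, hout]
      by_cases hs : (base comp G).Superfluous (cliqueOf comp G b)
      · simp [hs, hout₂, solutionsOf]
      · simp [hs, hout₂, solutionsOf]
    · by_cases hs : (base comp G).Superfluous (cliqueOf comp G b)
      · exact hdelay.append hlen' (by simp [superfluousCount, hs]) (by simp [superfluousCount, hs])
      · refine hdelay.append hlen' (by simp [superfluousCount, hs]) fun hne => ?_
        -- a round that outputs a solution contains an `emit`
        have h2 := outcome_fst_of_forall_ne_emit (S, []) τ₁ fun s hs' => hne s (by simp [hs'])
        rw [hout] at h2
        simp [hs] at h2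

theorem maximal_isClique_verts {comp : Bool} {G : SimpleGraph (Fin n)} {K : Set ℕ}
    (hK : MaxClique (BaseRel comp G) n K) : Maximal (base comp G).IsClique (verts n K) := by
  refine ⟨fun i hi j hj hij => ?_, fun J hJ hKJ i hi => ?_⟩
  · rw [← baseAdj_iff]
    exact (hK.clique i hi j hj).resolve_left fun H => hij (Fin.ext H)
  · by_contra hiK
    obtain ⟨w, hw, hn⟩ := hK.max i i.2 hiK
    refine hn (or_iff_not_imp_left.2 fun hne => ?_)
    have := (baseAdj_iff (comp := comp) (G := G) i ⟨w, hK.lt w hw⟩).2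
      (hJ hi (hKJ (show (⟨w, hK.lt w hw⟩ : Fin n) ∈ verts n K from hw))
        fun H => hne (congrArg Fin.val H))
    exact this

theorem maxClique_image_val {comp : Bool} {G : SimpleGraph (Fin n)} {J : Set (Fin n)}
    (hJ : Maximal (base comp G).IsClique J) :
    MaxClique (BaseRel comp G) n (Fin.val '' J) := by
  refine ⟨?_, ?_, ?_⟩
  · rintro _ ⟨i, -, rfl⟩
    exact i.2
  · rintro _ ⟨i, hi, rfl⟩ _ ⟨j, hj, rfl⟩
    by_cases hij : i = j
    · exact .inl (congrArg Fin.val hij)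
    · exact .inr ((baseAdj_iff i j).2 (hJ.prop hi hj hij))
  · intro u hu huJ
    by_contra! H
    refine huJ ⟨⟨u, hu⟩, SimpleGraph.mem_of_maximal hJ fun w hw hne => ?_, rfl⟩
    rw [← baseAdj_iff]
    exact (H w ⟨w, hw, rfl⟩).resolve_left fun h => hne (Fin.ext h.symm)

theorem maximal_cliqueOf {comp : Bool} {G : SimpleGraph (Fin n)} {b : Set ℕ}
    (hb : Valid (BaseRel comp G) n b) : Maximal (base comp G).IsClique (cliqueOf comp G b) :=
  maximal_isClique_verts (hb.maxClique (baseRel_refl comp G) (baseRel_symm comp G))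

theorem exists_cliqueOf_eq {comp : Bool} {G : SimpleGraph (Fin n)} {J : Set (Fin n)}
    (hJ : Maximal (base comp G).IsClique J) :
    ∃ b, Valid (BaseRel comp G) n b ∧ cliqueOf comp G b = J := by
  obtain ⟨b, hb, he⟩ := (maxClique_image_val hJ).exists_valid (baseRel_refl comp G)
    (baseRel_symm comp G)
  refine ⟨b, hb, ?_⟩
  ext i
  simp [cliqueOf, he, verts, Fin.val_inj]

theorem cliqueOf_injective {comp : Bool} {G : SimpleGraph (Fin n)} {b b' : Set ℕ}
    (hb : Valid (BaseRel comp G) n b) (hb' : Valid (BaseRel comp G) n b')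
    (h : cliqueOf comp G b = cliqueOf comp G b') : b = b' := by
  refine hb.path_injective (baseRel_refl comp G) (baseRel_symm comp G) hb' ?_
  have hK := hb.maxClique (baseRel_refl comp G) (baseRel_symm comp G)
  have hK' := hb'.maxClique (baseRel_refl comp G) (baseRel_symm comp G)
  ext u
  by_cases hu : u < n
  · exact Set.ext_iff.1 h ⟨u, hu⟩
  · exact ⟨fun H => absurd (hK.lt u H) hu, fun H => absurd (hK'.lt u H) hu⟩

/-- A superfluous clique is the closed neighborhood of a vertex, so there are at most `n`. -/
theorem superfluousCount_le (comp : Bool) (G : SimpleGraph (Fin n)) {l : List (Set ℕ)}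
    (hl : l.Nodup) (hv : ∀ b ∈ l, Valid (BaseRel comp G) n b) :
    superfluousCount comp G l ≤ n := by
  classical
  set C := base comp G
  rw [superfluousCount]
  rw [← List.toFinset_card_of_nodup (hl.filter _)]
  have hex : ∀ b, ∃ u, C.Superfluous (cliqueOf comp G b) →
      ∃ hu : u < n, (⟨u, hu⟩ : Fin n) ∈ cliqueOf comp G b ∧
        ∀ x, C.Adj ⟨u, hu⟩ x → x ∈ cliqueOf comp G b := by
    intro b
    by_cases h : C.Superfluous (cliqueOf comp G b)
    · obtain ⟨v, hv, hN, -⟩ := h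
      exact ⟨v, fun _ => ⟨v.2, hv, hN⟩⟩
    · exact ⟨0, fun H => absurd H h⟩
  choose f hf using hex
  refine (Finset.card_le_card_of_injOn (t := Finset.range n) f ?_ ?_).trans (by simp)
  · intro b hb
    simp only [List.coe_toFinset, List.mem_filter, decide_eq_true_eq, Set.mem_ofPred_eq] at hb
    obtain ⟨hu, -⟩ := hf b hb.2
    simpa using hu
  · intro b hb b' hb' he
    simp only [List.coe_toFinset, List.mem_filter, decide_eq_true_eq, Set.mem_ofPred_eq] at hb hb'
    obtain ⟨hu, h1, h2⟩ := hf b hb.2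
    obtain ⟨hu', h1', h2'⟩ := hf b' hb'.2
    have hn : ∀ {b : Set ℕ} {u : Fin n}, b ∈ l → u ∈ cliqueOf comp G b →
        (∀ x, C.Adj u x → x ∈ cliqueOf comp G b) →
        ∀ x, x ∈ cliqueOf comp G b ↔ x = u ∨ C.Adj u x := by
      intro b u hb hu hN x
      refine ⟨fun hx => or_iff_not_imp_left.2 fun hne => ?_, ?_⟩
      · exact (maximal_cliqueOf (hv b hb)).prop hu hx (Ne.symm hne)
      · rintro (rfl | h)
        exacts [hu, hN x h]
    refine cliqueOf_injective (hv b hb.1) (hv b' hb'.1) ?_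
    ext x
    rw [hn hb.1 h1 h2, hn hb'.1 h1' h2']
    simp only [he]

theorem tame_input (G : SimpleGraph (Fin n)) : (input G).Tame n := by
  refine ⟨fun x => ?_, fun a i => ?_, fun a i hi => ?_⟩
  · simp only [input]; split_ifs <;> nlinarith
  · simp only [input, adjBit]; split_ifs <;> simp
  · simp only [input, adjBit_eq_zero G hi, ite_self]

theorem represents_input (G : SimpleGraph (Fin n)) :
    Represents G 0 (fun _ => 0) (fun _ => ∅) ((input G).setReg 1 1) :=
  ⟨by simp [State.setReg, input], by simp, by simp, by simp, by simp [input], by simp [input]⟩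

/-- The solutions that the enumeration program outputs. -/
def IsSolution (comp : Bool) (G H : SimpleGraph (Fin n)) : Prop :=
  match comp with
  | true => G.IsMinimalSplitCompletion H
  | false => G.IsMinimalSplitDeletion H

theorem base_injective (comp : Bool) :
    Function.Injective (base comp : SimpleGraph (Fin n) → SimpleGraph (Fin n)) := by
  cases comp
  · exact Function.injective_id
  · exact compl_injective

theorem isSolution_iff {comp : Bool} {G H : SimpleGraph (Fin n)} : IsSolution comp G H ↔
    ∃ K, Maximal (base comp G).IsClique K ∧ ¬(base comp G).Superfluous K ∧
      solutionOf comp G K = H := by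
  cases comp
  · exact SimpleGraph.isMinimalSplitDeletion_iff
  · have : ∀ K, solutionOf true G K = H ↔ Gᶜ.touching K = Hᶜ := fun K => compl_eq_comm.trans eq_comm
    simp only [IsSolution, SimpleGraph.isMinimalSplitCompletion_iff_compl,
      SimpleGraph.isMinimalSplitDeletion_iff, this]
    rfl

theorem polyDelayPolySpace_isSolution (comp : Bool) :
    PolyDelayPolySpace (fun G H => IsSolution comp G H) := by
  classical
  refine ⟨enumProg comp, (Polynomial.X + 3) * roundTime comp,
    Polynomial.X * Polynomial.X + Polynomial.X + 2, fun n G => ?_⟩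
  have ht := tame_input G
  have ht₁ : ((input G).setReg 1 1).Tame n := ht.setReg (by omega)
  obtain ⟨τ, σ, l, hex, htame, hnd, hmem, hout, hdelay⟩ := exec_enumLoop comp G _ ∅ (fun _ => ∅)
    ((input G).setReg 1 1) [] rfl (valid_empty n) rfl ht₁ (by simp) (represents_input G)
  have hvalid : ∀ b, b ∈ l ↔ Valid (BaseRel comp G) n b := by
    intro b
    rw [hmem]
    exact and_iff_left (value_le_value (by simp))
  have hmem' : ∀ b, b ∈ l.filter (fun b => ¬(base comp G).Superfluous (cliqueOf comp G b)) ↔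
      Valid (BaseRel comp G) n b ∧ ¬(base comp G).Superfluous (cliqueOf comp G b) := by
    intro b
    simp [hvalid]
  have hT : 1 ≤ (roundTime comp).eval n := by simp [roundTime]
  refine ⟨[(.silent, (input G).setReg 1 1)] ++ τ, σ, .seq (.assign 1 (.const 1) _) hex,
    ⟨solutionsOf comp G l, ?_, fun H => ?_, ?_⟩, ?_, ?_, ?_⟩
  · refine (hnd.filter _).map_on fun b hb b' hb' he => ?_
    obtain ⟨hb, hs⟩ := (hmem' b).1 hb
    obtain ⟨hb', hs'⟩ := (hmem' b').1 hb'
    exact cliqueOf_injective hb hb' (SimpleGraph.touching_injective (maximal_cliqueOf hb)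
      (maximal_cliqueOf hb') hs hs' (base_injective comp he))
  · rw [solutionsOf, List.mem_map]
    refine Iff.trans ?_ isSolution_iff.symm
    constructor
    · rintro ⟨b, hb, rfl⟩
      obtain ⟨hb, hs⟩ := (hmem' b).1 hb
      exact ⟨_, maximal_cliqueOf hb, hs, rfl⟩
    · rintro ⟨K, hK, hs, rfl⟩
      obtain ⟨b, hb, rfl⟩ := exists_cliqueOf_eq hK
      exact ⟨b, (hmem' b).2 ⟨hb, hs⟩, rfl⟩
  · have := outcome_fst ([], []) τ
    rw [hout] at this
    simpa [solutions, solutionsFrom] using this.symm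
  · intro p hp hne
    have hr := superfluousCount_le comp G hnd fun b hb => (hvalid b).1 hb
    have := (BlockDelay.append (τ₁ := [(.silent, (input G).setReg 1 1)]) (r' := n + 1)
      (by simpa using hT) hdelay (by omega) (by omega)).2 p hp hne
    simpa [Nat.add_assoc] using this
  · simpa using ht.fitsIn
  · intro s hs
    have hs' : s.2.Tame n := by
      rcases List.mem_append.1 hs with hs | hs
      · rw [List.mem_singleton.1 hs]
        exact ht₁
      · exact htame s hs
    simpa using hs'.fitsIn

end RAM

theorem mainTheorem2 :
    RAM.PolyDelayPolySpace (fun G H => G.IsMinimalSplitCompletion H) ∧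
    RAM.PolyDelayPolySpace (fun G H => G.IsMinimalSplitDeletion H) :=
  ⟨RAM.polyDelayPolySpace_isSolution true, RAM.polyDelayPolySpace_isSolution false⟩
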